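/- For an integer $n\ge 2$ and a permutation $\pi$ of $\{1,\dots,n\}$, let $$d(\pi)=\min_{1\le i<j\le n}\bigl(|i-j|+|\pi(i)-\pi(j)|\bigr)$$ be its minimum Manhattan distance, and let $Y_n$ be the random variable $d(\pi)$, where $\pi$ is chosen uniformly from the symmetric group $S_n$. Let $Y$ be the integer-valued random variable with $\Pr[Y\ge d+2]=e^{-d^2-d}$ for every integer $d\ge 0$; that is, $\Pr[Y=d+2]=e^{-d^2-d}-e^{-(d+1)^2-(d+1)}$ for $d\ge 0$. Then for every fixed integer $a\ge 0$ the $a$-th moment of $Y$ is finite and $$\mathbb{E}[Y_n^a]\to\mathbb{E}[Y^a]\qquad (n\to\infty).$$ In particular, for $\pi\in S_n$ chosen uniformly, $$\mathbb{E}[d(\pi)]\to 1+\sum_{d=0}^{\infty}e^{-d^2-d}\approx 2.1378201816868795778\qquad (n\to\infty),$$ where the series converges and the decimal value is correct to 19 decimal places. -/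

import Mathlib

open MeasureTheory ProbabilityTheory Filter Topology

/-- The Manhattan (`L¹`) distance between the dots `(i, π i)` and `(j, π j)` of the graph of `π`. -/
def manhattanDist {n : ℕ} (π : Equiv.Perm (Fin n)) (i j : Fin n) : ℕ :=
  Nat.dist (i : ℕ) (j : ℕ) + Nat.dist (π i : ℕ) (π j : ℕ)

/-- The minimum Manhattan distance `d(π)`: the minimum of `|i - j| + |π(i) - π(j)|` over all
pairs `i < j`. It is meaningful for `n ≥ 2` (for `n ≤ 1` there are no pairs and the value is
the default `0`). -/
noncomputable def minManhattanDist {n : ℕ} (π : Equiv.Perm (Fin n)) : ℕ :=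
  sInf {m : ℕ | ∃ i j : Fin n, i < j ∧ manhattanDist π i j = m}

/-- The law of `Y_n = d(π)` for `π` chosen uniformly among all permutations of an `n`-set. -/
noncomputable def minDistLaw (n : ℕ) : PMF ℕ :=
  (PMF.uniformOfFintype (Equiv.Perm (Fin n))).map minManhattanDist

/-- The tail `e^{-d² - d}`. -/
noncomputable def limitTail (d : ℕ) : ℝ := Real.exp (-(d : ℝ) ^ 2 - (d : ℝ))

theorem limitTail_zero : limitTail 0 = 1 := by simp [limitTail]

theorem limitTail_succ_le (d : ℕ) : limitTail (d + 1) ≤ limitTail d := by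
  unfold limitTail
  apply Real.exp_le_exp.2
  push_cast
  nlinarith [(Nat.cast_nonneg d : (0 : ℝ) ≤ d)]

theorem tendsto_limitTail : Tendsto limitTail atTop (𝓝 0) := by
  refine squeeze_zero (fun d => (Real.exp_pos _).le) (fun d => ?_)
    ((Real.tendsto_exp_neg_atTop_nhds_zero).comp tendsto_natCast_atTop_atTop)
  apply Real.exp_le_exp.2
  nlinarith [sq_nonneg (d : ℝ)]

theorem hasSum_limitTail_sub :
    HasSum (fun d : ℕ => ENNReal.ofReal (limitTail d - limitTail (d + 1))) 1 := by
  have h : HasSum (fun d : ℕ => limitTail d - limitTail (d + 1)) 1 := by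
    rw [hasSum_iff_tendsto_nat_of_nonneg (fun d => sub_nonneg.2 (limitTail_succ_le d))]
    simp only [Finset.sum_range_sub', limitTail_zero]
    simpa using tendsto_limitTail.const_sub 1
  have h2 := ENNReal.ofReal_tsum_of_nonneg
    (fun d => sub_nonneg.2 (limitTail_succ_le d)) h.summable
  rw [h.tsum_eq, ENNReal.ofReal_one] at h2
  rw [h2]
  exact ENNReal.summable.hasSum

/-- The law of `Y - 2`: for every natural number `d`, the value `d` is taken with probability
`e^{-d² - d} - e^{-(d+1)² - (d+1)}`. -/
noncomputable def limitShiftedLaw : PMF ℕ :=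
  ⟨fun d => ENNReal.ofReal (limitTail d - limitTail (d + 1)), hasSum_limitTail_sub⟩

/-- The law of the limit variable `Y`: for every natural number `d`, the value `d + 2` is taken
with probability `e^{-d² - d} - e^{-(d+1)² - (d+1)}`. -/
noncomputable def limitLaw : PMF ℕ :=
  limitShiftedLaw.map (fun d => d + 2)

/-! Put D = d + 1. Then d(π) ≥ d + 2 exactly when the graph of π has no two dots at distance at most
D. There are D(D - 1) difference vectors for such a pair, listed from left to right, so the grid
contains about D(D - 1)n² close pairs, each lying on a random graph with probability about n⁻².
Their number should be asymptotically Poisson with mean D(D - 1) = d² + d, hence zero with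
probability tending to e^{-d² - d}.

The method of factorial moments (`tendsto_card_eq_zero_of_factorial_moments`) is applied to isolated
pairs, those with no third dot nearby. Distinct isolated pairs occupy disjoint places, so tuples
need no analysis of overlaps (`card_isolated_tuple_le`); tuples of far apart pairs give a matching
lower bound (`le_card_isolated_tuple`). Close pairs without any isolated one force three nearby
dots, which has probability O(1/n) (`card_closePair_no_isolated_le`).

Convergence of moments also needs tails bounded uniformly in n. The pairs of places 2t, 2t + 1 are
examined in turn: given the earlier ones, each stays spread by L with probability at most exp(-(L -
4)/(2n)), and there are about n/4 of them (`card_lt_minManhattanDist_le`). Dominated convergence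
does the rest. -/

/-! ### Counting permutations and tuples -/

/-- The number of permutations with prescribed distinct values at prescribed distinct places. -/
theorem card_perm_prescribed {α ι : Type*} [Fintype α] [DecidableEq α] [Fintype ι]
    (p v : ι → α) (hp : Function.Injective p) (hv : Function.Injective v) :
    (Finset.univ.filter (fun π : Equiv.Perm α => ∀ i, π (p i) = v i)).card =
      (Fintype.card α - Fintype.card ι).factorial := by
  classical
  let e₀ : Set.range p ≃ Set.range v :=
    (Equiv.ofInjective p hp).symm.trans (Equiv.ofInjective v hv)
  have h1 : Fintype.card (Set.range p) = Fintype.card ι := Set.card_range_of_injective hp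
  have h2 : Fintype.card (Set.range v) = Fintype.card ι := Set.card_range_of_injective hv
  have h3 : Fintype.card ((Set.range p)ᶜ : Set α) = Fintype.card α - Fintype.card ι := by
    rw [Fintype.card_compl_set, h1]
  have h4 : Fintype.card ((Set.range v)ᶜ : Set α) = Fintype.card α - Fintype.card ι := by
    rw [Fintype.card_compl_set, h2]
  have e₁ : ((Set.range p)ᶜ : Set α) ≃ ((Set.range v)ᶜ : Set α) :=
    Fintype.equivOfCardEq (h3.trans h4.symm)
  rw [← h3, ← Fintype.card_equiv e₁, ← Fintype.card_congr (Equiv.Set.compl e₀),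
    Fintype.card_subtype]
  congr 1
  ext π
  simp only [Finset.mem_filter, Finset.mem_univ, true_and, Subtype.forall, Set.mem_range]
  constructor
  · rintro h _ ⟨i, rfl⟩
    have : (Equiv.ofInjective p hp).symm ⟨p i, ⟨i, rfl⟩⟩ = i :=
      Equiv.ofInjective_symm_apply hp i
    simp [e₀, this, h i]
  · intro h i
    have : (Equiv.ofInjective p hp).symm ⟨p i, ⟨i, rfl⟩⟩ = i :=
      Equiv.ofInjective_symm_apply hp i
    simpa [e₀, this] using h (p i) ⟨i, rfl⟩

/-- Without injectivity of the values no permutation qualifies, so only the places need to be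
distinct. -/
theorem card_perm_prescribed_le {α ι : Type*} [Fintype α] [DecidableEq α] [Fintype ι]
    (p v : ι → α) (hp : Function.Injective p) :
    (Finset.univ.filter (fun π : Equiv.Perm α => ∀ i, π (p i) = v i)).card ≤
      (Fintype.card α - Fintype.card ι).factorial := by
  classical
  by_cases hv : Function.Injective v
  · exact (card_perm_prescribed p v hp hv).le
  · rw [Finset.card_eq_zero.2]
    · exact Nat.zero_le _
    · refine Finset.filter_eq_empty_iff.2 fun π _ h => hv fun i j hij => hp ?_
      exact π.injective (by rw [h, h, hij])

/-- Turns a factorial moment into a count of tuples of distinct elements. -/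
theorem card_injective_mem {α : Type*} [Fintype α] [DecidableEq α] (A : Finset α) (r : ℕ) :
    (Finset.univ.filter (fun f : Fin r → α => Function.Injective f ∧ ∀ t, f t ∈ A)).card =
      A.card.descFactorial r := by
  classical
  have h := Fintype.card_embedding_eq (α := Fin r) (β := A)
  rw [Fintype.card_coe, Fintype.card_fin] at h
  rw [← h, ← Fintype.card_subtype]
  refine Fintype.card_congr ⟨fun f => ⟨fun t => ⟨f.1 t, f.2.2 t⟩, fun s t hst => ?_⟩,
    fun g => ⟨fun t => g t, fun s t hst => g.injective (Subtype.ext hst), fun t => (g t).2⟩,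
    fun f => rfl, fun g => rfl⟩
  exact f.2.1 (by simpa using hst)

/-! ### Bonferroni inequalities and the method of factorial moments -/

/-- For w > 0 the truncated alternating sum collapses to ±C(w - 1, R). -/
theorem abs_indicator_sub_alternating_sum_le (w R : ℕ) :
    |(if w = 0 then (1 : ℝ) else 0) - ∑ r ∈ Finset.range (R + 1), (-1) ^ r * (w.choose r : ℝ)| ≤
      w.choose R := by
  rcases Nat.eq_zero_or_pos w with rfl | hw
  · rw [Finset.sum_eq_single_of_mem 0 (by simp)]
    · simp
    · intro r _ hr
      obtain ⟨r, rfl⟩ := Nat.exists_eq_succ_of_ne_zero hr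
      simp
  · obtain ⟨m, rfl⟩ := Nat.exists_eq_succ_of_ne_zero hw.ne'
    have h := Int.alternating_sum_range_choose_eq_choose (n := m) (m := R)
    have h' : ∑ r ∈ Finset.range (R + 1), (-1 : ℝ) ^ r * ((m + 1).choose r : ℝ) =
        (-1) ^ R * (m.choose R : ℝ) := by exact_mod_cast h
    simp only [Nat.succ_eq_add_one, h', Nat.add_eq_zero_iff, one_ne_zero, and_false, if_false,
      zero_sub, abs_neg, abs_mul, abs_pow, abs_one, one_pow, one_mul, Nat.abs_cast]
    exact_mod_cast Nat.choose_le_choose R (Nat.le_succ m)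

/-- Convergence of all factorial moments to those of a Poisson variable gives convergence of the
probability of the value zero. -/
theorem tendsto_card_eq_zero_of_factorial_moments {Ω : ℕ → Type*} [∀ n, Fintype (Ω n)]
    (W : ∀ n, Ω n → ℕ) (N : ℕ → ℝ) (hN : ∀ n, N n = Fintype.card (Ω n)) (l : ℝ)
    (h : ∀ r : ℕ, Tendsto (fun n => (∑ x, ((W n x).descFactorial r : ℝ)) / N n) atTop (𝓝 (l ^ r))) :
    Tendsto (fun n => ((Finset.univ.filter (fun x => W n x = 0)).card : ℝ) / N n) atTop
      (𝓝 (Real.exp (-l))) := by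
  have hN0 : ∀ n, 0 ≤ N n := fun n => by rw [hN]; positivity
  have hc : ∀ r : ℕ, Tendsto (fun n => (∑ x, ((W n x).choose r : ℝ)) / N n) atTop
      (𝓝 (l ^ r / r.factorial)) := fun r => by
    refine ((h r).div_const _).congr fun n => ?_
    rw [div_right_comm, Finset.sum_div]
    congr 1
    refine Finset.sum_congr rfl fun x _ => ?_
    rw [Nat.descFactorial_eq_factorial_mul_choose]
    push_cast
    field_simp
  have hs : HasSum (fun r : ℕ => (-l) ^ r / r.factorial) (Real.exp (-l)) := by
    rw [Real.exp_eq_exp_ℝ]; exact NormedSpace.expSeries_div_hasSum_exp (-l)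
  have h0 : Tendsto (fun r : ℕ => l ^ r / r.factorial) atTop (𝓝 0) :=
    FloorSemiring.tendsto_pow_div_factorial_atTop l
  have hs' := (hs.tendsto_sum_nat).comp (tendsto_add_atTop_nat 1)
  rw [Metric.tendsto_atTop]
  intro ε hε
  -- Four errors of ε/4: the tail of the exponential series, the convergence of the truncated sum,
  -- the limit of the R-th binomial moment, and the distance of that moment from its limit.
  obtain ⟨R, hR1, hR2⟩ := ((Metric.tendsto_nhds.1 hs' (ε / 4) (by positivity)).and
    (Metric.tendsto_nhds.1 h0 (ε / 4) (by positivity))).exists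
  have hsum : Tendsto (fun n => ∑ r ∈ Finset.range (R + 1),
      (-1) ^ r * ((∑ x, ((W n x).choose r : ℝ)) / N n)) atTop
      (𝓝 (∑ r ∈ Finset.range (R + 1), (-1) ^ r * (l ^ r / r.factorial))) :=
    tendsto_finsetSum _ fun r _ => (hc r).const_mul _
  have e1 : (∑ r ∈ Finset.range (R + 1), (-1) ^ r * (l ^ r / r.factorial) : ℝ) =
      ∑ r ∈ Finset.range (R + 1), (-l) ^ r / r.factorial :=
    Finset.sum_congr rfl fun r _ => by rw [neg_pow]; ring
  rw [e1] at hsum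
  have hev := ((Metric.tendsto_nhds.1 hsum (ε / 4) (by positivity)).and
    (Metric.tendsto_nhds.1 (hc R) (ε / 4) (by positivity)))
  obtain ⟨n₀, hn₀⟩ := eventually_atTop.1 hev
  refine ⟨n₀, fun n hn => ?_⟩
  obtain ⟨b1, b2⟩ := hn₀ n hn
  have key : |((Finset.univ.filter (fun x => W n x = 0)).card : ℝ) / N n -
      ∑ r ∈ Finset.range (R + 1), (-1) ^ r * ((∑ x, ((W n x).choose r : ℝ)) / N n)| ≤
      (∑ x, ((W n x).choose R : ℝ)) / N n := by
    have e2 : ((Finset.univ.filter (fun x => W n x = 0)).card : ℝ) / N n -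
      ∑ r ∈ Finset.range (R + 1), (-1) ^ r * ((∑ x, ((W n x).choose r : ℝ)) / N n) =
      (∑ x, ((if W n x = 0 then (1 : ℝ) else 0) -
        ∑ r ∈ Finset.range (R + 1), (-1) ^ r * ((W n x).choose r : ℝ))) / N n := by
      rw [Finset.sum_sub_distrib, Finset.sum_comm, sub_div]
      congr 1
      · simp
      · rw [Finset.sum_div]
        refine Finset.sum_congr rfl fun r _ => ?_
        rw [← Finset.mul_sum, mul_div_assoc]
    rw [e2, abs_div, abs_of_nonneg (hN0 n)]
    refine div_le_div_of_nonneg_right ?_ (hN0 n)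
    exact (Finset.abs_sum_le_sum_abs _ _).trans
      (Finset.sum_le_sum fun x _ => abs_indicator_sub_alternating_sum_le _ _)
  simp only [Real.dist_eq, Function.comp] at *
  rw [abs_lt] at *
  rw [abs_le] at key
  constructor <;> linarith [key.1, key.2]

/-! ### Asymptotics of factorial ratios -/

theorem tendsto_pow_div_descFactorial (r : ℕ) :
    Tendsto (fun n : ℕ => (n : ℝ) ^ r / (n.descFactorial r : ℝ)) atTop (𝓝 1) := by
  have h := (isEquivalent_descFactorial r).symm
  exact (Asymptotics.isEquivalent_iff_tendsto_one (by
    filter_upwards [eventually_ge_atTop r] with n hn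
    have := Nat.pos_of_ne_zero (mt Nat.descFactorial_eq_zero_iff_lt.1 (not_lt.2 hn))
    positivity)).1 h

theorem factorial_sub_div_factorial {n r : ℕ} (h : r ≤ n) :
    ((n - r).factorial : ℝ) / n.factorial = 1 / (n.descFactorial r : ℝ) := by
  rw [← Nat.factorial_mul_descFactorial h]
  push_cast
  field_simp

theorem tendsto_pow_mul_factorial_sub (r : ℕ) :
    Tendsto (fun n : ℕ => (n : ℝ) ^ r * (((n - r).factorial : ℝ) / n.factorial)) atTop (𝓝 1) := by
  refine (tendsto_pow_div_descFactorial r).congr' ?_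
  filter_upwards [eventually_ge_atTop r] with n hn
  rw [factorial_sub_div_factorial hn, mul_one_div]

/-! ### Close pairs in the grid -/

/-- Pairs of dots of the `n × n` grid at Manhattan distance at most `D`, in different rows and
columns, listed from left to right. -/
def closePairs (n D : ℕ) : Finset ((Fin n × Fin n) × (Fin n × Fin n)) :=
  Finset.univ.filter fun e => e.1.1 < e.2.1 ∧ e.1.2 ≠ e.2.2 ∧
    Nat.dist e.1.1 e.2.1 + Nat.dist e.1.2 e.2.2 ≤ D

/-- The possible second dots of a close pair with a given first dot. -/
def closeDots {n : ℕ} (D : ℕ) (x : Fin n × Fin n) : Finset (Fin n × Fin n) :=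
  Finset.univ.filter fun y => x.1 < y.1 ∧ x.2 ≠ y.2 ∧ Nat.dist x.1 y.1 + Nat.dist x.2 y.2 ≤ D

/-- The difference vectors `(a + 1, b)` of close pairs. -/
noncomputable def closeDiffs (D : ℕ) : Finset (Σ _ : ℕ, ℤ) :=
  (Finset.range D).sigma fun a => (Finset.Icc (-((D - 1 - a : ℕ) : ℤ)) ((D - 1 - a : ℕ) : ℤ)).erase 0

theorem card_closeDiffs (D : ℕ) : (closeDiffs D).card = D * (D - 1) := by
  have h : ∀ a : ℕ, ((Finset.Icc (-((D - 1 - a : ℕ) : ℤ)) ((D - 1 - a : ℕ) : ℤ)).erase 0).card =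
      (D - 1 - a) * 2 := fun a => by
    rw [Finset.card_erase_of_mem (by simp), Int.card_Icc]
    omega
  rw [closeDiffs, Finset.card_sigma, Finset.sum_congr rfl fun a _ => h a, ← Finset.sum_mul,
    Finset.sum_range_reflect (fun i => i) D, Finset.sum_range_id_mul_two]

theorem mapsTo_closeDots {n : ℕ} (D : ℕ) (x : Fin n × Fin n) :
    Set.MapsTo (fun y : Fin n × Fin n => (⟨(y.1 : ℕ) - x.1 - 1, (y.2 : ℤ) - x.2⟩ : Σ _ : ℕ, ℤ))
      (closeDots D x) (closeDiffs D) := by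
  rintro ⟨⟨a, ha⟩, ⟨b, hb⟩⟩ hy
  obtain ⟨⟨c, hc⟩, ⟨d, hd⟩⟩ := x
  simp only [closeDots, closeDiffs, Finset.mem_coe, Finset.mem_filter, Finset.mem_univ, true_and,
    Fin.mk_lt_mk, ne_eq, Fin.mk.injEq, Finset.mem_sigma, Finset.mem_range,
    Finset.mem_erase, Finset.mem_Icc] at hy ⊢
  simp only [Nat.dist] at hy
  omega

theorem injOn_closeDots {n : ℕ} (D : ℕ) (x : Fin n × Fin n) :
    Set.InjOn (fun y : Fin n × Fin n => (⟨(y.1 : ℕ) - x.1 - 1, (y.2 : ℤ) - x.2⟩ : Σ _ : ℕ, ℤ))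
      (closeDots D x) := by
  rintro ⟨⟨a, ha⟩, ⟨b, hb⟩⟩ hy ⟨⟨a', ha'⟩, ⟨b', hb'⟩⟩ hy' h
  obtain ⟨⟨c, hc⟩, ⟨d, hd⟩⟩ := x
  simp only [closeDots, Finset.mem_coe, Finset.mem_filter, Finset.mem_univ, true_and,
    Fin.mk_lt_mk, Sigma.mk.injEq, heq_eq_eq, Prod.mk.injEq, Fin.mk.injEq] at hy hy' h ⊢
  omega

theorem card_closeDots_le {n : ℕ} (D : ℕ) (x : Fin n × Fin n) :
    (closeDots D x).card ≤ D * (D - 1) := by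
  rw [← card_closeDiffs]
  exact Finset.card_le_card_of_injOn _ (mapsTo_closeDots D x) (injOn_closeDots D x)

/-- Away from the right, lower and upper edges every difference vector is realised; the left edge is
harmless because second dots lie to the right. -/
theorem le_card_closeDots {n : ℕ} (D : ℕ) (x : Fin n × Fin n) (h1 : (x.1 : ℕ) + D < n)
    (h2 : D ≤ (x.2 : ℕ)) (h3 : (x.2 : ℕ) + D < n) : D * (D - 1) ≤ (closeDots D x).card := by
  rw [← card_closeDiffs]
  refine Finset.card_le_card_of_surjOn (fun y : Fin n × Fin n =>
    (⟨(y.1 : ℕ) - x.1 - 1, (y.2 : ℤ) - x.2⟩ : Σ _ : ℕ, ℤ)) ?_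
  rintro ⟨a, b⟩ hab
  simp only [closeDiffs, Finset.mem_coe, Finset.mem_sigma, Finset.mem_range,
    Finset.mem_erase, Finset.mem_Icc] at hab
  obtain ⟨⟨c, hc⟩, ⟨d, hd⟩⟩ := x
  simp only at h1 h2 h3
  refine ⟨⟨⟨c + a + 1, by omega⟩, ⟨((d : ℤ) + b).toNat, by omega⟩⟩, ?_, ?_⟩
  · simp only [closeDots, Finset.mem_coe, Finset.mem_filter, Finset.mem_univ, true_and,
      Fin.mk_lt_mk, ne_eq, Fin.mk.injEq]
    simp only [Nat.dist]
    omega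
  · simp only [Sigma.mk.injEq, heq_eq_eq]
    omega

theorem card_filter_closePairs {n : ℕ} (D : ℕ) (P : Fin n × Fin n → Prop) [DecidablePred P] :
    ((closePairs n D).filter fun e => P e.1).card =
      ∑ x with P x, (closeDots D x).card := by
  rw [closePairs, Finset.filter_filter, Finset.card_filter, Fintype.sum_prod_type,
    Finset.sum_filter]
  refine Finset.sum_congr rfl fun x _ => ?_
  rw [closeDots, Finset.card_filter]
  split_ifs with h <;> simp [h]

theorem card_filter_closePairs_le {n : ℕ} (D : ℕ) (P : Fin n × Fin n → Prop) [DecidablePred P] :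
    ((closePairs n D).filter fun e => P e.1).card ≤
      (Finset.univ.filter P).card * (D * (D - 1)) := by
  rw [card_filter_closePairs, ← smul_eq_mul]
  exact Finset.sum_le_card_nsmul _ _ _ fun x _ => card_closeDots_le D x

theorem card_closePairs_le (n D : ℕ) : (closePairs n D).card ≤ n * n * (D * (D - 1)) := by
  simpa using card_filter_closePairs_le (n := n) D fun _ => True

theorem card_filter_Ico_fin (n a b : ℕ) (hb : b ≤ n) :
    (Finset.univ.filter fun i : Fin n => a ≤ (i : ℕ) ∧ (i : ℕ) < b).card = b - a := by
  rw [← Nat.card_Ico a b]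
  refine Finset.card_bij (fun i _ => (i : ℕ)) (by simp) (fun i _ j _ h => Fin.ext h) ?_
  intro c hc
  rw [Finset.mem_Ico] at hc
  exact ⟨⟨c, by omega⟩, by simpa using hc, rfl⟩

theorem le_card_closePairs (n D : ℕ) :
    (n - 2 * D) * (n - 2 * D) * (D * (D - 1)) ≤ (closePairs n D).card := by
  have h := card_filter_closePairs (n := n) D fun _ => True
  simp only [Finset.filter_true] at h
  rw [h]
  let S : Finset (Fin n) := Finset.univ.filter fun i => D ≤ (i : ℕ) ∧ (i : ℕ) < n - D
  have hS : S.card = n - 2 * D := by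
    rw [card_filter_Ico_fin n D (n - D) (Nat.sub_le _ _)]; omega
  calc (n - 2 * D) * (n - 2 * D) * (D * (D - 1)) = (S ×ˢ S).card • (D * (D - 1)) := by
        rw [Finset.card_product, hS, smul_eq_mul]
    _ ≤ ∑ x ∈ S ×ˢ S, (closeDots D x).card := by
        refine Finset.card_nsmul_le_sum _ _ _ fun x hx => ?_
        simp only [S, Finset.mem_product, Finset.mem_filter, Finset.mem_univ, true_and] at hx
        exact le_card_closeDots D x (by omega) (by omega) (by omega)
    _ ≤ ∑ x, (closeDots D x).card :=
        Finset.sum_le_sum_of_subset (Finset.subset_univ _)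

theorem tendsto_natCast_sub_div (c : ℕ) :
    Tendsto (fun n : ℕ => ((n - c : ℕ) : ℝ) / n) atTop (𝓝 1) := by
  have h : Tendsto (fun n : ℕ => 1 - (c : ℝ) / n) atTop (𝓝 (1 - 0)) :=
    (tendsto_const_div_atTop_nhds_zero_nat (c : ℝ)).const_sub 1
  rw [sub_zero] at h
  refine h.congr' ?_
  filter_upwards [eventually_ge_atTop c, eventually_gt_atTop 0] with n hn hn0
  rw [Nat.cast_sub hn]
  field_simp

/-- The limit is the Poisson mean; boundary effects cost only O(n) pairs. -/
theorem tendsto_card_closePairs_div (D : ℕ) :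
    Tendsto (fun n : ℕ => ((closePairs n D).card : ℝ) / (n : ℝ) ^ 2) atTop
      (𝓝 ((D * (D - 1) : ℕ) : ℝ)) := by
  have h1 : Tendsto (fun n : ℕ => (((n - 2 * D : ℕ) : ℝ) / n) * (((n - 2 * D : ℕ) : ℝ) / n) *
      ((D * (D - 1) : ℕ) : ℝ)) atTop (𝓝 (1 * 1 * ((D * (D - 1) : ℕ) : ℝ))) :=
    ((tendsto_natCast_sub_div _).mul (tendsto_natCast_sub_div _)).mul_const _
  rw [one_mul, one_mul] at h1
  refine tendsto_of_tendsto_of_tendsto_of_le_of_le' h1 tendsto_const_nhds ?_ ?_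
  · filter_upwards [eventually_gt_atTop 0] with n hn
    have hn' : (0 : ℝ) < n := by exact_mod_cast hn
    have h := le_card_closePairs n D
    rw [le_div_iff₀ (by positivity)]
    calc _ = (((n - 2 * D) * (n - 2 * D) * (D * (D - 1)) : ℕ) : ℝ) := by
          push_cast; field_simp
      _ ≤ _ := by exact_mod_cast h
  · filter_upwards [eventually_gt_atTop 0] with n hn
    have hn' : (0 : ℝ) < n := by exact_mod_cast hn
    have h := card_closePairs_le n D
    rw [div_le_iff₀ (by positivity)]
    calc _ ≤ ((n * n * (D * (D - 1)) : ℕ) : ℝ) := by exact_mod_cast h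
      _ = _ := by push_cast; ring

theorem card_filter_dist_le {n : ℕ} (K : ℕ) (c : Fin n) :
    (Finset.univ.filter fun i : Fin n => Nat.dist i c ≤ K).card ≤ 2 * K + 1 := by
  calc _ ≤ (Finset.Icc ((c : ℕ) - K) (c + K)).card := by
        refine Finset.card_le_card_of_injOn (fun i => (i : ℕ)) (fun i hi => ?_)
          (fun i _ j _ h => Fin.ext h)
        simp only [Finset.mem_coe, Finset.mem_filter, Finset.mem_univ, true_and] at hi
        simp only [Nat.dist] at hi
        simp only [Finset.coe_Icc, Set.mem_Icc]
        omega
    _ ≤ _ := by rw [Nat.card_Icc]; omega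

/-- The first dot lies in a vertical or horizontal strip of width 2K + 1, so only O(n) of the order
n² pairs are lost. -/
theorem card_filter_closePairs_near_le {n : ℕ} (D K : ℕ) (c : Fin n × Fin n) :
    ((closePairs n D).filter fun e => ¬ (K < Nat.dist e.1.1 c.1 ∧ K < Nat.dist e.1.2 c.2)).card ≤
      2 * (2 * K + 1) * (D * (D - 1)) * n := by
  refine (card_filter_closePairs_le D
    (fun x => ¬ (K < Nat.dist x.1 c.1 ∧ K < Nat.dist x.2 c.2))).trans ?_
  have hsub : (Finset.univ.filter fun x : Fin n × Fin n =>
      ¬ (K < Nat.dist x.1 c.1 ∧ K < Nat.dist x.2 c.2)) ⊆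
      (Finset.univ.filter fun i : Fin n => Nat.dist i c.1 ≤ K) ×ˢ Finset.univ ∪
        Finset.univ ×ˢ (Finset.univ.filter fun i : Fin n => Nat.dist i c.2 ≤ K) := by
    intro x hx
    simp only [Finset.mem_filter, Finset.mem_univ, true_and, Finset.mem_union, Finset.mem_product,
      and_true] at hx ⊢
    omega
  have hle := (Finset.card_le_card hsub).trans (Finset.card_union_le _ _)
  rw [Finset.card_product, Finset.card_product, Finset.card_univ, Fintype.card_fin] at hle
  have h1 := Nat.mul_le_mul_right n (card_filter_dist_le K c.1)
  have h2 := Nat.mul_le_mul_left n (card_filter_dist_le K c.2)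
  calc _ ≤ ((2 * K + 1) * n + n * (2 * K + 1)) * (D * (D - 1)) :=
        Nat.mul_le_mul_right _ (hle.trans (Nat.add_le_add h1 h2))
    _ = _ := by ring

/-- Separation above 2D would suffice here; 3D is what `le_card_isolated_tuple` needs to keep the
dots of other pairs out of the isolation range. -/
theorem Nat.ne_of_far_of_near {a a' b b' D : ℕ} (h : 3 * D < Nat.dist a a')
    (h1 : Nat.dist a b ≤ D) (h2 : Nat.dist a' b' ≤ D) : a ≠ a' ∧ b ≠ b' ∧ a ≠ b' := by
  simp only [Nat.dist] at *
  omega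

/-- This is the source of the radius 2D in `isolatedPairs`. -/
theorem Nat.dist_le_of_near {a a' b b' D : ℕ} (h : a = a' ∨ b = b' ∨ a = b')
    (h1 : Nat.dist a b ≤ D) (h2 : Nat.dist a' b' ≤ D) :
    Nat.dist a' a ≤ 2 * D ∧ Nat.dist b' a ≤ 2 * D := by
  simp only [Nat.dist] at *
  omega

/-! ### Isolated pairs and tuples of them -/

/-- The close pairs of dots of the graph of `π` which have no further dot of the graph nearby. -/
def isolatedPairs {n : ℕ} (D : ℕ) (π : Equiv.Perm (Fin n)) :
    Finset ((Fin n × Fin n) × (Fin n × Fin n)) :=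
  (closePairs n D).filter fun e => π e.1.1 = e.1.2 ∧ π e.2.1 = e.2.2 ∧
    ∀ i : Fin n, Nat.dist i e.1.1 ≤ 2 * D → Nat.dist (π i) e.1.2 ≤ 2 * D → i = e.1.1 ∨ i = e.2.1

/-- Isolation of `e` forces both dots of `f` to be dots of `e`, and the left-to-right order matches
them up. -/
theorem eq_of_near_of_mem_isolatedPairs {n D : ℕ} {π : Equiv.Perm (Fin n)}
    {e f : (Fin n × Fin n) × (Fin n × Fin n)} (he : e ∈ isolatedPairs D π)
    (hf : f ∈ isolatedPairs D π)
    (h : (Nat.dist f.1.1 e.1.1 ≤ 2 * D ∧ Nat.dist f.1.2 e.1.2 ≤ 2 * D) ∧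
      (Nat.dist f.2.1 e.1.1 ≤ 2 * D ∧ Nat.dist f.2.2 e.1.2 ≤ 2 * D)) : e = f := by
  simp only [isolatedPairs, closePairs, Finset.mem_filter, Finset.mem_univ, true_and] at he hf
  obtain ⟨⟨he1, -, -⟩, he2, he3, hiso⟩ := he
  obtain ⟨⟨hf1, -, -⟩, hf2, hf3, -⟩ := hf
  have h1 := hiso f.1.1 h.1.1 (by rw [hf2]; exact h.1.2)
  have h2 := hiso f.2.1 h.2.1 (by rw [hf3]; exact h.2.2)
  have h3 : f.1.1 = e.1.1 ∧ f.2.1 = e.2.1 := by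
    rcases h1 with h1 | h1 <;> rcases h2 with h2 | h2
    · rw [h1, h2] at hf1; exact absurd hf1 (lt_irrefl _)
    · exact ⟨h1, h2⟩
    · rw [h1, h2] at hf1; exact absurd hf1 he1.not_gt
    · rw [h1, h2] at hf1; exact absurd hf1 (lt_irrefl _)
  ext
  · rw [h3.1]
  · rw [← he2, ← hf2, h3.1]
  · rw [h3.2]
  · rw [← he3, ← hf3, h3.2]

/-- The places occupied by a tuple of pairs of dots. -/
def places {n r : ℕ} (f : Fin r → (Fin n × Fin n) × (Fin n × Fin n)) : Fin r ⊕ Fin r → Fin n :=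
  Sum.elim (fun t => (f t).1.1) (fun t => (f t).2.1)

/-- The values occupied by a tuple of pairs of dots. -/
def values {n r : ℕ} (f : Fin r → (Fin n × Fin n) × (Fin n × Fin n)) : Fin r ⊕ Fin r → Fin n :=
  Sum.elim (fun t => (f t).1.2) (fun t => (f t).2.2)

theorem mem_closePairs {n D : ℕ} {e : (Fin n × Fin n) × (Fin n × Fin n)} :
    e ∈ closePairs n D ↔ e.1.1 < e.2.1 ∧ e.1.2 ≠ e.2.2 ∧
      Nat.dist e.1.1 e.2.1 + Nat.dist e.1.2 e.2.2 ≤ D := by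
  simp [closePairs]

theorem mem_isolatedPairs {n D : ℕ} {π : Equiv.Perm (Fin n)}
    {e : (Fin n × Fin n) × (Fin n × Fin n)} :
    e ∈ isolatedPairs D π ↔ e ∈ closePairs n D ∧ π e.1.1 = e.1.2 ∧ π e.2.1 = e.2.2 ∧
      ∀ i : Fin n, Nat.dist i e.1.1 ≤ 2 * D → Nat.dist (π i) e.1.2 ≤ 2 * D → i = e.1.1 ∨ i = e.2.1 := by
  simp [isolatedPairs]

/-- Pairs on the graph of `π` that share a place share the whole dot, so they are near in both
coordinates and isolation identifies them. -/
theorem injective_places_of_isolated {n D r : ℕ} {π : Equiv.Perm (Fin n)}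
    {f : Fin r → (Fin n × Fin n) × (Fin n × Fin n)} (hf : Function.Injective f)
    (h : ∀ t, f t ∈ isolatedPairs D π) : Function.Injective (places f) := by
  have hd : ∀ t, _ := fun t => (mem_closePairs.1 (mem_isolatedPairs.1 (h t)).1)
  have h1 : ∀ t, π (f t).1.1 = (f t).1.2 := fun t => (mem_isolatedPairs.1 (h t)).2.1
  have h2 : ∀ t, π (f t).2.1 = (f t).2.2 := fun t => (mem_isolatedPairs.1 (h t)).2.2.1
  have hx : ∀ t, Nat.dist (f t).1.1 (f t).2.1 ≤ D := fun t => Nat.le_of_add_right_le (hd t).2.2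
  have hy : ∀ t, Nat.dist (f t).1.2 (f t).2.2 ≤ D := fun t => Nat.le_of_add_left_le (hd t).2.2
  have key : ∀ s t, ((f s).1.1 = (f t).1.1 ∧ (f s).1.2 = (f t).1.2) ∨
      ((f s).2.1 = (f t).2.1 ∧ (f s).2.2 = (f t).2.2) ∨
      ((f s).1.1 = (f t).2.1 ∧ (f s).1.2 = (f t).2.2) → s = t := fun s t hst => by
    have a1 := Nat.dist_le_of_near (by
      rcases hst with h | h | h
      · exact Or.inl (congrArg Fin.val h.1)
      · exact Or.inr (Or.inl (congrArg Fin.val h.1))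
      · exact Or.inr (Or.inr (congrArg Fin.val h.1))) (hx s) (hx t)
    have a2 := Nat.dist_le_of_near (by
      rcases hst with h | h | h
      · exact Or.inl (congrArg Fin.val h.2)
      · exact Or.inr (Or.inl (congrArg Fin.val h.2))
      · exact Or.inr (Or.inr (congrArg Fin.val h.2))) (hy s) (hy t)
    exact hf (eq_of_near_of_mem_isolatedPairs (h s) (h t) ⟨⟨a1.1, a2.1⟩, a1.2, a2.2⟩)
  refine Function.Injective.sumElim
    (fun s t hst => key s t (Or.inl ⟨hst, by rw [← h1, ← h1, hst]⟩))
    (fun s t hst => key s t (Or.inr (Or.inl ⟨hst, by rw [← h2, ← h2, hst]⟩)))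
    (fun s t hst => ?_)
  have e1 := key s t (Or.inr (Or.inr ⟨hst, by rw [← h1, ← h2, hst]⟩))
  rw [e1] at hst
  exact (hd t).1.ne hst

theorem card_isolated_tuple_le {n D r : ℕ} {f : Fin r → (Fin n × Fin n) × (Fin n × Fin n)}
    (hf : Function.Injective f) :
    (Finset.univ.filter fun π : Equiv.Perm (Fin n) => ∀ t, f t ∈ isolatedPairs D π).card ≤
      (n - 2 * r).factorial := by
  -- A single permutation `π₀` in the set certifies that the 2r places are distinct; with none there
  -- is nothing to count.
  rcases (Finset.univ.filter fun π : Equiv.Perm (Fin n) =>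
    ∀ t, f t ∈ isolatedPairs D π).eq_empty_or_nonempty with h | ⟨π₀, h⟩
  · rw [h]; exact Nat.zero_le _
  · have hp := injective_places_of_isolated hf (Finset.mem_filter.1 h).2
    have h2 := card_perm_prescribed_le (places f) (values f) hp
    rw [Fintype.card_sum, Fintype.card_fin, Fintype.card_fin, ← two_mul] at h2
    refine le_trans (Finset.card_le_card fun π hπ => ?_) h2
    simp only [Finset.mem_filter, Finset.mem_univ, true_and] at hπ ⊢
    rintro (t | t)
    · exact (mem_isolatedPairs.1 (hπ t)).2.1
    · exact (mem_isolatedPairs.1 (hπ t)).2.2.1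

/-- One more dot at a new place saves a further factor of order n. -/
theorem card_perm_prescribed_extra_le {n : ℕ} {ι : Type*} [Fintype ι] (p v : ι → Fin n)
    (hp : Function.Injective p) (y : Fin n × Fin n) :
    (Finset.univ.filter fun π : Equiv.Perm (Fin n) =>
      (∀ i, π (p i) = v i) ∧ (∀ i, y.1 ≠ p i) ∧ π y.1 = y.2).card ≤
      (n - (Fintype.card ι + 1)).factorial := by
  by_cases h : ∀ i, y.1 ≠ p i
  · have hinj : Function.Injective (fun o : Option ι => o.elim y.1 p) := by
      rintro (_ | i) (_ | j) hij
      · rfl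
      · exact absurd hij (h j)
      · exact absurd hij.symm (h i)
      · exact congrArg some (hp hij)
    have h2 := card_perm_prescribed_le (fun o : Option ι => o.elim y.1 p)
      (fun o : Option ι => o.elim y.2 v) hinj
    rw [Fintype.card_option, Fintype.card_fin] at h2
    refine le_trans (Finset.card_le_card fun π hπ => ?_) h2
    simp only [Finset.mem_filter, Finset.mem_univ, true_and] at hπ ⊢
    rintro (_ | i)
    · exact hπ.2.2
    · exact hπ.1 i
  · rw [Finset.filter_eq_empty_iff.2 fun π _ hπ => h hπ.2.1]
    exact Nat.zero_le _

/-- The grid points close to `x` in both coordinates. -/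
def nearDots {n : ℕ} (K : ℕ) (x : Fin n × Fin n) : Finset (Fin n × Fin n) :=
  (Finset.univ.filter fun i : Fin n => Nat.dist i x.1 ≤ K) ×ˢ
    (Finset.univ.filter fun i : Fin n => Nat.dist i x.2 ≤ K)

theorem card_nearDots_le {n : ℕ} (K : ℕ) (x : Fin n × Fin n) :
    (nearDots K x).card ≤ (2 * K + 1) ^ 2 := by
  rw [nearDots, Finset.card_product, sq]
  exact Nat.mul_le_mul (card_filter_dist_le _ _) (card_filter_dist_le _ _)

/-- Tuples of close pairs which are pairwise far apart in both coordinates. -/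
def farTuples (n D r : ℕ) : Finset (Fin r → (Fin n × Fin n) × (Fin n × Fin n)) :=
  (Fintype.piFinset fun _ => closePairs n D).filter fun f => ∀ s t, s ≠ t →
    3 * D < Nat.dist (f s).1.1 (f t).1.1 ∧ 3 * D < Nat.dist (f s).1.2 (f t).1.2

theorem mem_farTuples {n D r : ℕ} {f : Fin r → (Fin n × Fin n) × (Fin n × Fin n)} :
    f ∈ farTuples n D r ↔ (∀ t, f t ∈ closePairs n D) ∧ ∀ s t, s ≠ t →
      3 * D < Nat.dist (f s).1.1 (f t).1.1 ∧ 3 * D < Nat.dist (f s).1.2 (f t).1.2 := by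
  simp [farTuples]

theorem injective_of_mem_farTuples {n D r : ℕ} {f : Fin r → (Fin n × Fin n) × (Fin n × Fin n)}
    (hf : f ∈ farTuples n D r) : Function.Injective f := by
  intro s t hst
  by_contra hne
  have h := ((mem_farTuples.1 hf).2 s t hne).1
  rw [hst, Nat.dist_self] at h
  omega

theorem injective_places_of_far {n D r : ℕ} {f : Fin r → (Fin n × Fin n) × (Fin n × Fin n)}
    (hf : f ∈ farTuples n D r) : Function.Injective (places f) := by
  obtain ⟨h1, h2⟩ := mem_farTuples.1 hf
  have hd : ∀ t, _ := fun t => mem_closePairs.1 (h1 t)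
  have key : ∀ s t, (f s).1.1 = (f t).1.1 ∨ (f s).2.1 = (f t).2.1 ∨ (f s).1.1 = (f t).2.1 →
      s = t := fun s t hst => by
    by_contra hne
    have a := Nat.ne_of_far_of_near (h2 s t hne).1 (Nat.le_of_add_right_le (hd s).2.2)
      (Nat.le_of_add_right_le (hd t).2.2)
    simp only [Fin.ext_iff] at hst
    tauto
  refine Function.Injective.sumElim (fun s t hst => key s t (Or.inl hst))
    (fun s t hst => key s t (Or.inr (Or.inl hst))) (fun s t hst => ?_)
  have e1 := key s t (Or.inr (Or.inr hst))
  rw [e1] at hst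
  exact (hd t).1.ne hst

theorem injective_values_of_far {n D r : ℕ} {f : Fin r → (Fin n × Fin n) × (Fin n × Fin n)}
    (hf : f ∈ farTuples n D r) : Function.Injective (values f) := by
  obtain ⟨h1, h2⟩ := mem_farTuples.1 hf
  have hd : ∀ t, _ := fun t => mem_closePairs.1 (h1 t)
  have key : ∀ s t, (f s).1.2 = (f t).1.2 ∨ (f s).2.2 = (f t).2.2 ∨ (f s).1.2 = (f t).2.2 →
      s = t := fun s t hst => by
    by_contra hne
    have a := Nat.ne_of_far_of_near (h2 s t hne).2 (Nat.le_of_add_left_le (hd s).2.2)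
      (Nat.le_of_add_left_le (hd t).2.2)
    simp only [Fin.ext_iff] at hst
    tauto
  refine Function.Injective.sumElim (fun s t hst => key s t (Or.inl hst))
    (fun s t hst => key s t (Or.inr (Or.inl hst))) (fun s t hst => ?_)
  have e1 := key s t (Or.inr (Or.inr hst))
  rw [e1] at hst
  exact (hd t).2.1 hst

/-- Exactly (n - 2r)! permutations pass through all the dots. If some pair fails to be isolated,
there is a further dot at one of at most (4D + 1)² positions around one of r first dots. -/
theorem le_card_isolated_tuple {n D r : ℕ} {f : Fin r → (Fin n × Fin n) × (Fin n × Fin n)}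
    (hf : f ∈ farTuples n D r) :
    (n - 2 * r).factorial ≤
      (Finset.univ.filter fun π : Equiv.Perm (Fin n) => ∀ t, f t ∈ isolatedPairs D π).card +
        r * (4 * D + 1) ^ 2 * (n - (2 * r + 1)).factorial := by
  classical
  have hp := injective_places_of_far hf
  have h1 := card_perm_prescribed (places f) (values f) hp (injective_values_of_far hf)
  rw [Fintype.card_sum, Fintype.card_fin, Fintype.card_fin, ← two_mul] at h1
  obtain ⟨hc, hfar⟩ := mem_farTuples.1 hf
  have hd : ∀ t, _ := fun t => mem_closePairs.1 (hc t)
  let B : Fin r → Finset (Equiv.Perm (Fin n)) := fun t =>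
    (nearDots (2 * D) (f t).1).biUnion fun y => Finset.univ.filter fun π : Equiv.Perm (Fin n) =>
      (∀ i, π (places f i) = values f i) ∧ (∀ i, y.1 ≠ places f i) ∧ π y.1 = y.2
  have hB : ∀ t, (B t).card ≤ (4 * D + 1) ^ 2 * (n - (2 * r + 1)).factorial := fun t => by
    refine (Finset.card_biUnion_le_card_mul _ _ _ fun y _ =>
      (card_perm_prescribed_extra_le _ _ hp y)).trans ?_
    rw [Fintype.card_sum, Fintype.card_fin, ← two_mul]
    refine Nat.mul_le_mul_right _ ((card_nearDots_le _ _).trans_eq ?_)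
    ring
  have hU : (Finset.univ.biUnion B).card ≤ r * (4 * D + 1) ^ 2 * (n - (2 * r + 1)).factorial := by
    refine (Finset.card_biUnion_le_card_mul _ _ _ fun t _ => hB t).trans_eq ?_
    rw [Finset.card_univ, Fintype.card_fin, mul_assoc]
  rw [← h1]
  refine le_trans (Finset.card_le_card (t := (Finset.univ.filter fun π : Equiv.Perm (Fin n) =>
    ∀ t, f t ∈ isolatedPairs D π) ∪ Finset.univ.biUnion B) fun π hπ => ?_)
    ((Finset.card_union_le _ _).trans (Nat.add_le_add_left hU _))
  rw [Finset.mem_union, or_iff_not_imp_left]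
  intro hnot
  simp only [Finset.mem_filter, Finset.mem_univ, true_and, not_forall] at hπ hnot
  obtain ⟨t, ht⟩ := hnot
  have ht1 : π (f t).1.1 = (f t).1.2 := hπ (Sum.inl t)
  have ht2 : π (f t).2.1 = (f t).2.2 := hπ (Sum.inr t)
  rw [mem_isolatedPairs] at ht
  push Not at ht
  obtain ⟨i, hi1, hi2, hi3, hi4⟩ := ht (hc t) ht1 ht2
  simp only [Finset.mem_biUnion, Finset.mem_univ, true_and, B]
  refine ⟨t, (i, π i), ?_, ?_⟩
  · simp [nearDots, hi1, hi2]
  · simp only [Finset.mem_filter, Finset.mem_univ, true_and, and_true]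
    refine ⟨hπ, ?_⟩
    -- For `s ≠ t` the dots of `f s` are at horizontal distance more than 3D - D = 2D from the first
    -- dot of `f t`, so the intruder `i` is none of them.
    have key : ∀ s, i ≠ (f s).1.1 ∧ i ≠ (f s).2.1 := fun s => by
      by_cases hst : s = t
      · rw [hst]; exact ⟨hi3, hi4⟩
      · have a0 := (hfar s t hst).1
        have a1 := Nat.le_of_add_right_le (hd s).2.2
        have a2 : Nat.dist i (f t).1.1 ≤ 2 * D := hi1
        constructor <;> intro hi <;> rw [hi] at a2 <;> clear hi hi1 hi2 hi3 hi4 <;>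
          simp only [Nat.dist] at a0 a1 a2 <;> omega
    rintro (s | s)
    · exact (key s).1
    · exact (key s).2

theorem card_pair_extra_le {n K : ℕ} {e : (Fin n × Fin n) × (Fin n × Fin n)}
    (he : e.1.1 ≠ e.2.1) :
    ((nearDots K e.1).biUnion fun y => Finset.univ.filter fun π : Equiv.Perm (Fin n) =>
      (π e.1.1 = e.1.2 ∧ π e.2.1 = e.2.2) ∧ (y.1 ≠ e.1.1 ∧ y.1 ≠ e.2.1) ∧ π y.1 = y.2).card ≤
      (2 * K + 1) ^ 2 * (n - 3).factorial := by
  have hp : Function.Injective ![e.1.1, e.2.1] := by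
    intro a b
    fin_cases a <;> fin_cases b <;> simp [he, he.symm]
  refine (Finset.card_biUnion_le_card_mul _ _ ((n - 3).factorial) fun y _ => ?_).trans
    (Nat.mul_le_mul_right _ (card_nearDots_le K e.1))
  refine le_trans (Finset.card_le_card fun π hπ => ?_)
    (card_perm_prescribed_extra_le ![e.1.1, e.2.1] ![e.1.2, e.2.2] hp y)
  simp only [Finset.mem_filter, Finset.mem_univ, true_and] at hπ ⊢
  rw [Fin.forall_fin_two, Fin.forall_fin_two]
  exact hπ

/-! ### Close pairs that are not isolated -/

/-- The close pairs of dots of the graph of `π`. -/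
def graphPairs {n : ℕ} (D : ℕ) (π : Equiv.Perm (Fin n)) :
    Finset ((Fin n × Fin n) × (Fin n × Fin n)) :=
  (closePairs n D).filter fun e => π e.1.1 = e.1.2 ∧ π e.2.1 = e.2.2

/-- A union bound over a close pair and a third dot near it: order n² · (n - 3)!, which is O(n!/n).
-/
theorem card_closePair_no_isolated_le (n D : ℕ) :
    (Finset.univ.filter fun π : Equiv.Perm (Fin n) => (isolatedPairs D π).card = 0 ∧
      (graphPairs D π).card ≠ 0).card ≤
      (closePairs n D).card * ((2 * (2 * D) + 1) ^ 2 * (n - 3).factorial) := by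
  classical
  have hU := Finset.card_biUnion_le_card_mul (closePairs n D) (fun e =>
    (nearDots (2 * D) e.1).biUnion fun y => Finset.univ.filter fun π : Equiv.Perm (Fin n) =>
      (π e.1.1 = e.1.2 ∧ π e.2.1 = e.2.2) ∧ (y.1 ≠ e.1.1 ∧ y.1 ≠ e.2.1) ∧ π y.1 = y.2) _
    fun e he => card_pair_extra_le (K := 2 * D) (mem_closePairs.1 he).1.ne
  refine le_trans (Finset.card_le_card fun π hπ => ?_) hU
  simp only [Finset.mem_filter, Finset.mem_univ, true_and, Finset.card_eq_zero] at hπ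
  obtain ⟨h0, hne⟩ := hπ
  obtain ⟨e, he⟩ := Finset.card_ne_zero.1 hne
  obtain ⟨he, he1, he2⟩ := Finset.mem_filter.1 he
  have hn : e ∉ isolatedPairs D π := by rw [h0]; simp
  rw [mem_isolatedPairs] at hn
  push Not at hn
  obtain ⟨i, hi1, hi2, hi3, hi4⟩ := hn he he1 he2
  rw [Finset.mem_biUnion]
  refine ⟨e, he, ?_⟩
  rw [Finset.mem_biUnion]
  refine ⟨(i, π i), by simp [nearDots, hi1, hi2], ?_⟩
  rw [Finset.mem_filter]
  exact ⟨Finset.mem_univ _, ⟨he1, he2⟩, ⟨hi3, hi4⟩, rfl⟩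

/-! ### Convergence of the factorial moments -/

theorem card_farTuples_le (n D r : ℕ) : (farTuples n D r).card ≤ (closePairs n D).card ^ r := by
  refine (Finset.card_filter_le _ _).trans_eq ?_
  rw [Fintype.card_piFinset_const]

/-- A far tuple is extended by prepending a close pair; each of its r members forbids only O(n)
candidates. -/
theorem card_farTuples_succ (n D r : ℕ) :
    (farTuples n D r).card * (closePairs n D).card ≤ (farTuples n D (r + 1)).card +
      (farTuples n D r).card * (r * (2 * (2 * (3 * D) + 1) * (D * (D - 1)) * n)) := by
  classical
  let G : (Fin r → (Fin n × Fin n) × (Fin n × Fin n)) →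
      Finset ((Fin n × Fin n) × (Fin n × Fin n)) := fun f => (closePairs n D).filter fun e =>
    ∀ t, 3 * D < Nat.dist e.1.1 (f t).1.1 ∧ 3 * D < Nat.dist e.1.2 (f t).1.2
  have h1 : ∀ f ∈ farTuples n D r, (closePairs n D).card ≤ (G f).card +
      r * (2 * (2 * (3 * D) + 1) * (D * (D - 1)) * n) := fun f _ => by
    have hb := Finset.card_biUnion_le_card_mul (Finset.univ : Finset (Fin r))
      (fun t => (closePairs n D).filter fun e =>
        ¬ (3 * D < Nat.dist e.1.1 (f t).1.1 ∧ 3 * D < Nat.dist e.1.2 (f t).1.2)) _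
      (fun t _ => card_filter_closePairs_near_le D (3 * D) (f t).1)
    rw [Finset.card_univ, Fintype.card_fin] at hb
    refine le_trans (Finset.card_le_card fun e he => ?_)
      ((Finset.card_union_le (G f) _).trans (Nat.add_le_add_left hb _))
    rw [Finset.mem_union, or_iff_not_imp_left]
    intro hG
    simp only [G, Finset.mem_filter, he, true_and, not_forall] at hG
    obtain ⟨t, ht⟩ := hG
    simp only [Finset.mem_biUnion, Finset.mem_univ, true_and, Finset.mem_filter, he]
    exact ⟨t, ht⟩
  have h2 : ∑ f ∈ farTuples n D r, (G f).card ≤ (farTuples n D (r + 1)).card := by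
    rw [← Finset.card_sigma]
    refine Finset.card_le_card_of_injOn
      (fun x => Fin.cons (α := fun _ => (Fin n × Fin n) × (Fin n × Fin n)) x.2 x.1) ?_ ?_
    · rintro ⟨f, e⟩ hx
      simp only [Finset.mem_coe, Finset.mem_sigma, G, Finset.mem_filter] at hx
      obtain ⟨hf, he, hfar⟩ := hx
      obtain ⟨hc, hff⟩ := mem_farTuples.1 hf
      rw [Finset.mem_coe, mem_farTuples]
      refine ⟨fun t => Fin.cases he hc t, fun s t => ?_⟩
      refine Fin.cases ?_ (fun s => ?_) s <;> refine Fin.cases ?_ (fun t => ?_) t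
      · exact fun h => absurd rfl h
      · exact fun _ => hfar t
      · intro _
        simpa only [Fin.cons_zero, Fin.cons_succ, Nat.dist_comm] using hfar s
      · exact fun h => hff s t fun h' => h (h' ▸ rfl)
    · rintro ⟨f, e⟩ _ ⟨f', e'⟩ _ h
      obtain ⟨ha, hb⟩ := Fin.cons_inj.1 h
      simp only at ha hb
      subst ha hb
      rfl
  calc _ = ∑ f ∈ farTuples n D r, (closePairs n D).card := by
        rw [Finset.sum_const, smul_eq_mul]
    _ ≤ ∑ f ∈ farTuples n D r, ((G f).card + r * (2 * (2 * (3 * D) + 1) * (D * (D - 1)) * n)) :=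
        Finset.sum_le_sum h1
    _ ≤ _ := by
        rw [Finset.sum_add_distrib, Finset.sum_const, smul_eq_mul]
        exact Nat.add_le_add_right h2 _

theorem tendsto_card_farTuples_div (D r : ℕ) :
    Tendsto (fun n : ℕ => ((farTuples n D r).card : ℝ) / (n : ℝ) ^ (2 * r)) atTop
      (𝓝 (((D * (D - 1) : ℕ) : ℝ) ^ r)) := by
  have hE := tendsto_card_closePairs_div D
  induction r with
  | zero =>
    refine tendsto_const_nhds.congr fun n => ?_
    have : (farTuples n D 0).card = 1 := by
      rw [farTuples, Finset.filter_true_of_mem fun f _ s => s.elim0, Fintype.card_piFinset_const,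
        pow_zero]
    simp [this]
  | succ r ih =>
    set C : ℕ := r * (2 * (2 * (3 * D) + 1) * (D * (D - 1))) with hC
    have hlow := ih.mul (hE.sub (tendsto_const_div_atTop_nhds_zero_nat (C : ℝ)))
    rw [sub_zero, ← pow_succ] at hlow
    refine tendsto_of_tendsto_of_tendsto_of_le_of_le' hlow (hE.pow (r + 1)) ?_ ?_
    · filter_upwards [eventually_gt_atTop 0] with n hn
      have hn' : (0 : ℝ) < n := by exact_mod_cast hn
      have h := card_farTuples_succ n D r
      have h' : ((farTuples n D r).card : ℝ) * (closePairs n D).card ≤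
          (farTuples n D (r + 1)).card + (farTuples n D r).card * (C * n) := by
        rw [hC]
        have h2 : (farTuples n D r).card * (closePairs n D).card ≤
            (farTuples n D (r + 1)).card + (farTuples n D r).card *
              (r * (2 * (2 * (3 * D) + 1) * (D * (D - 1))) * n) := by
          refine h.trans_eq ?_
          ring
        exact_mod_cast h2
      rw [le_div_iff₀ (by positivity)]
      calc _ = ((farTuples n D r).card : ℝ) * (closePairs n D).card -
            (farTuples n D r).card * (C * n) := by field_simp; ring
        _ ≤ _ := by linarith
    · filter_upwards with n
      rw [div_pow, ← pow_mul]
      refine div_le_div_of_nonneg_right ?_ (by positivity)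
      exact_mod_cast card_farTuples_le n D (r + 1)

/-- Double counting of permutations together with tuples of distinct isolated pairs. -/
theorem sum_descFactorial_isolatedPairs_eq (n D r : ℕ) :
    ∑ π : Equiv.Perm (Fin n), (isolatedPairs D π).card.descFactorial r =
      ∑ f : Fin r → (Fin n × Fin n) × (Fin n × Fin n), (Finset.univ.filter
        fun π : Equiv.Perm (Fin n) => Function.Injective f ∧ ∀ t, f t ∈ isolatedPairs D π).card := by
  simp_rw [← card_injective_mem, Finset.card_filter]
  exact Finset.sum_comm

theorem sum_descFactorial_isolatedPairs_le (n D r : ℕ) :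
    ∑ π : Equiv.Perm (Fin n), (isolatedPairs D π).card.descFactorial r ≤
      (closePairs n D).card ^ r * (n - 2 * r).factorial := by
  rw [sum_descFactorial_isolatedPairs_eq, ← Fintype.card_piFinset_const, ← smul_eq_mul,
    ← Finset.sum_const]
  refine le_trans (le_of_eq (Finset.sum_subset (Finset.subset_univ _) fun f _ hf => ?_).symm)
    (Finset.sum_le_sum fun f _ => ?_)
  · refine Finset.card_eq_zero.2 (Finset.filter_eq_empty_iff.2 fun π _ hπ => hf ?_)
    exact Fintype.mem_piFinset.2 fun t => (mem_isolatedPairs.1 (hπ.2 t)).1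
  · by_cases hi : Function.Injective f
    · simpa [hi] using card_isolated_tuple_le (D := D) hi
    · simp [hi]

theorem le_sum_descFactorial_isolatedPairs (n D r : ℕ) :
    (farTuples n D r).card * (n - 2 * r).factorial ≤
      ∑ π : Equiv.Perm (Fin n), (isolatedPairs D π).card.descFactorial r +
      (farTuples n D r).card * (r * (4 * D + 1) ^ 2 * (n - (2 * r + 1)).factorial) := by
  rw [sum_descFactorial_isolatedPairs_eq, ← smul_eq_mul, ← Finset.sum_const]
  refine (Finset.sum_le_sum fun f hf => le_card_isolated_tuple hf).trans ?_
  rw [Finset.sum_add_distrib, Finset.sum_const, smul_eq_mul]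
  refine Nat.add_le_add_right (le_trans (Finset.sum_le_sum fun f hf => ?_)
    (Finset.sum_le_sum_of_subset (Finset.subset_univ (farTuples n D r)))) _
  simp [injective_of_mem_farTuples hf]

theorem tendsto_factorial_moment_isolatedPairs (D r : ℕ) :
    Tendsto (fun n : ℕ => (∑ π : Equiv.Perm (Fin n),
      ((isolatedPairs D π).card.descFactorial r : ℝ)) / (n.factorial : ℝ)) atTop
      (𝓝 (((D * (D - 1) : ℕ) : ℝ) ^ r)) := by
  have hP := tendsto_pow_mul_factorial_sub (2 * r)
  have hup := ((tendsto_card_closePairs_div D).pow r).mul hP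
  -- The intruder term carries (n - 2r - 1)!/n!, one power of n smaller than the main term.
  have hP' := (tendsto_pow_mul_factorial_sub (2 * r + 1)).mul
    (tendsto_const_div_atTop_nhds_zero_nat ((r * (4 * D + 1) ^ 2 : ℕ) : ℝ))
  have hlow := (tendsto_card_farTuples_div D r).mul (hP.sub hP')
  rw [mul_zero, sub_zero, mul_one] at hlow
  rw [mul_one] at hup
  refine tendsto_of_tendsto_of_tendsto_of_le_of_le' hlow hup ?_ ?_
  · filter_upwards [eventually_gt_atTop 0] with n hn
    have hn' : (0 : ℝ) < n := by exact_mod_cast hn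
    have h : ((farTuples n D r).card : ℝ) * (n - 2 * r).factorial ≤
      ∑ π : Equiv.Perm (Fin n), ((isolatedPairs D π).card.descFactorial r : ℝ) +
      (farTuples n D r).card * ((r * (4 * D + 1) ^ 2 : ℕ) * (n - (2 * r + 1)).factorial) := by
      exact_mod_cast le_sum_descFactorial_isolatedPairs n D r
    have hf : (0 : ℝ) < n.factorial := by positivity
    rw [le_div_iff₀ hf]
    calc _ = ((farTuples n D r).card : ℝ) * (n - 2 * r).factorial - (farTuples n D r).card *
          ((r * (4 * D + 1) ^ 2 : ℕ) * (n - (2 * r + 1)).factorial) := by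
          rw [pow_succ]; field_simp
      _ ≤ _ := by linarith
  · filter_upwards [eventually_gt_atTop 0] with n hn
    have hn' : (0 : ℝ) < n := by exact_mod_cast hn
    have h : ∑ π : Equiv.Perm (Fin n), ((isolatedPairs D π).card.descFactorial r : ℝ) ≤
        (closePairs n D).card ^ r * (n - 2 * r).factorial := by
      exact_mod_cast sum_descFactorial_isolatedPairs_le n D r
    have hf : (0 : ℝ) < n.factorial := by positivity
    rw [div_le_iff₀ hf]
    refine h.trans_eq ?_
    rw [div_pow, ← pow_mul]
    field_simp

/-! ### The limiting tails -/

theorem le_minManhattanDist_iff {n : ℕ} (hn : 2 ≤ n) (π : Equiv.Perm (Fin n)) (m : ℕ) :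
    m ≤ minManhattanDist π ↔ ∀ i j, i < j → m ≤ manhattanDist π i j := by
  -- Two places are needed so that the infimum is attained and is not the default value 0.
  have hne : {m : ℕ | ∃ i j : Fin n, i < j ∧ manhattanDist π i j = m}.Nonempty :=
    ⟨_, ⟨0, by omega⟩, ⟨1, by omega⟩, by simp, rfl⟩
  constructor
  · exact fun h i j hij => h.trans (Nat.sInf_le ⟨i, j, hij, rfl⟩)
  · intro h
    obtain ⟨i, j, hij, hm⟩ := Nat.sInf_mem hne
    rw [minManhattanDist, ← hm]
    exact h i j hij

theorem le_minManhattanDist_iff_closePairs {n : ℕ} (hn : 2 ≤ n) (π : Equiv.Perm (Fin n)) (D : ℕ) :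
    D + 1 ≤ minManhattanDist π ↔ (graphPairs D π).card = 0 := by
  rw [le_minManhattanDist_iff hn, Finset.card_eq_zero, graphPairs, Finset.filter_eq_empty_iff]
  constructor
  · rintro h e he ⟨h1, h2⟩
    obtain ⟨h3, -, h4⟩ := mem_closePairs.1 he
    have := h _ _ h3
    rw [manhattanDist, h1, h2] at this
    omega
  · intro h i j hij
    by_contra hlt
    refine h (x := ((i, π i), (j, π j))) (mem_closePairs.2 ⟨hij, ?_, ?_⟩) ⟨rfl, rfl⟩
    · exact fun he => hij.ne (π.injective he)
    · exact Nat.lt_succ_iff.1 (not_le.1 hlt)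

/-- The limit law of the minimum Manhattan distance, in terms of tails. -/
theorem tendsto_card_le_minManhattanDist (d : ℕ) :
    Tendsto (fun n : ℕ => ((Finset.univ.filter fun π : Equiv.Perm (Fin n) =>
      d + 2 ≤ minManhattanDist π).card : ℝ) / (n.factorial : ℝ)) atTop (𝓝 (limitTail d)) := by
  have hW := tendsto_card_eq_zero_of_factorial_moments
    (fun n (π : Equiv.Perm (Fin n)) => (isolatedPairs (d + 1) π).card) (fun n => (n.factorial : ℝ))
    (fun n => by rw [Fintype.card_perm, Fintype.card_fin]) _
    (tendsto_factorial_moment_isolatedPairs (d + 1))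
  have hlim : Real.exp (-(((d + 1) * (d + 1 - 1) : ℕ) : ℝ)) = limitTail d := by
    rw [limitTail, Nat.add_sub_cancel]; push_cast; ring_nf
  rw [hlim] at hW
  -- The event of no isolated pair exceeds the event of no close pair by this set of permutations,
  -- of vanishing density.
  have hE : Tendsto (fun n : ℕ => ((Finset.univ.filter fun π : Equiv.Perm (Fin n) =>
      (isolatedPairs (d + 1) π).card = 0 ∧ (graphPairs (d + 1) π).card ≠ 0).card : ℝ) /
      (n.factorial : ℝ)) atTop (𝓝 0) := by
    have hb := ((tendsto_card_closePairs_div (d + 1)).mul (tendsto_pow_mul_factorial_sub 3)).mul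
      (tendsto_const_div_atTop_nhds_zero_nat (((2 * (2 * (d + 1)) + 1) ^ 2 : ℕ) : ℝ))
    rw [mul_zero] at hb
    refine squeeze_zero' (Eventually.of_forall fun n => by positivity) ?_ hb
    filter_upwards [eventually_gt_atTop 0] with n hn
    have hn' : (0 : ℝ) < n := by exact_mod_cast hn
    have h : ((Finset.univ.filter fun π : Equiv.Perm (Fin n) =>
      (isolatedPairs (d + 1) π).card = 0 ∧ (graphPairs (d + 1) π).card ≠ 0).card : ℝ) ≤
      (closePairs n (d + 1)).card * (((2 * (2 * (d + 1)) + 1) ^ 2 : ℕ) * (n - 3).factorial) := by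
      exact_mod_cast card_closePair_no_isolated_le n (d + 1)
    have hf : (0 : ℝ) < n.factorial := by positivity
    rw [div_le_iff₀ hf]
    refine h.trans_eq ?_
    field_simp
  have hsub := hW.sub hE
  rw [sub_zero] at hsub
  refine hsub.congr' ?_
  filter_upwards [eventually_ge_atTop 2] with n hn
  rw [← sub_div]
  congr 1
  rw [sub_eq_iff_eq_add]
  norm_cast
  rw [← Finset.card_union_of_disjoint]
  · congr 1
    ext π
    simp only [Finset.mem_filter, Finset.mem_univ, true_and, Finset.mem_union]
    have hiff : d + 2 ≤ minManhattanDist π ↔ _ := le_minManhattanDist_iff_closePairs hn π (d + 1)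
    rw [hiff]
    constructor
    · tauto
    · rintro (h | h)
      · rw [Finset.card_eq_zero, Finset.eq_empty_iff_forall_notMem]
        rw [Finset.card_eq_zero, Finset.eq_empty_iff_forall_notMem] at h
        exact fun e he => h e (Finset.mem_filter.2 ⟨(mem_isolatedPairs.1 he).1,
          (mem_isolatedPairs.1 he).2.1, (mem_isolatedPairs.1 he).2.2.1⟩)
      · exact h.1
  · refine Finset.disjoint_left.2 fun π h1 h2 => ?_
    exact (Finset.mem_filter.1 h2).2.2
      ((le_minManhattanDist_iff_closePairs hn π (d + 1)).1 (Finset.mem_filter.1 h1).2)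

/-! ### Exponential tails uniform in n -/

/-- The permutations taking each of the first `k` pairs of places `2t, 2t + 1` to values at
distance at least `L`. -/
def spreadPerms (n L k : ℕ) : Finset (Equiv.Perm (Fin n)) :=
  Finset.univ.filter fun π => ∀ i j : Fin n, ∀ t < k, (i : ℕ) = 2 * t → (j : ℕ) = 2 * t + 1 →
    L ≤ Nat.dist (π i) (π j)

theorem card_spreadPerms_close_le {n L k : ℕ} {p q u v : Fin n} (hp : (p : ℕ) = 2 * k)
    (hq : (q : ℕ) = 2 * k + 1) (hu : 2 * k ≤ (u : ℕ)) (hv : 2 * k ≤ (v : ℕ)) (huv : u ≠ v) :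
    ((spreadPerms n L k).filter fun π => Nat.dist (π u) (π v) < L).card ≤
      ((spreadPerms n L k).filter fun π => Nat.dist (π p) (π q) < L).card := by
  -- `w` is chosen so that `σ` sends `p` to `u` and `q` to `v` while fixing all places below 2k;
  -- composition with `σ` then preserves `spreadPerms`.
  let w := Equiv.swap p u v
  let σ : Equiv.Perm (Fin n) := Equiv.swap p u * Equiv.swap q w
  have hpq : p ≠ q := fun h => by rw [Fin.ext_iff] at h; omega
  have hwp : p ≠ w := by
    intro h
    have h' := congrArg (Equiv.swap p u) h
    rw [Equiv.swap_apply_left] at h'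
    exact huv (h'.trans (Equiv.swap_apply_self p u v))
  have hσp : σ p = u := by
    simp only [σ, Equiv.Perm.mul_apply]
    rw [Equiv.swap_apply_of_ne_of_ne hpq hwp, Equiv.swap_apply_left]
  have hσq : σ q = v := by
    simp only [σ, Equiv.Perm.mul_apply]
    rw [Equiv.swap_apply_left]
    exact Equiv.swap_apply_self p u v
  have hwk : 2 * k ≤ (w : ℕ) := by
    simp only [w, Equiv.swap_apply_def]
    split_ifs <;> omega
  have hσ : ∀ j : Fin n, (j : ℕ) < 2 * k → σ j = j := fun j hj => by
    have h1 : j ≠ p := fun h => by rw [h] at hj; omega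
    have h2 : j ≠ q := fun h => by rw [h] at hj; omega
    have h3 : j ≠ u := fun h => by rw [h] at hj; omega
    have h4 : j ≠ w := fun h => by rw [h] at hj; omega
    simp only [σ, Equiv.Perm.mul_apply]
    rw [Equiv.swap_apply_of_ne_of_ne h2 h4, Equiv.swap_apply_of_ne_of_ne h1 h3]
  refine Finset.card_le_card_of_injOn (fun π => π * σ) (fun π hπ => ?_)
    fun π _ π' _ h => mul_right_cancel h
  simp only [Finset.mem_coe, Finset.mem_filter, spreadPerms, Finset.mem_univ, true_and,
    Equiv.Perm.mul_apply, hσp, hσq] at hπ ⊢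
  refine ⟨fun i j t ht hi hj => ?_, hπ.2⟩
  rw [hσ i (by omega), hσ j (by omega)]
  exact hπ.1 i j t ht hi hj

/-- Cauchy–Schwarz applied to the sizes of the fibres of `g`. -/
theorem sq_card_le_card_same_window {n : ℕ} (Q : Finset (Fin n)) (g : Fin n → ℕ) (B : ℕ)
    (hg : ∀ u, g u < B) :
    Q.card ^ 2 ≤ B * ((Q ×ˢ Q).filter fun x => g x.1 = g x.2).card := by
  have h1 : Q.card = ∑ w ∈ Finset.range B, (Q.filter fun u => g u = w).card :=
    Finset.card_eq_sum_card_fiberwise fun u _ => Finset.mem_coe.2 (Finset.mem_range.2 (hg u))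
  have h2 : ((Q ×ˢ Q).filter fun x => g x.1 = g x.2).card =
      ∑ w ∈ Finset.range B, (Q.filter fun u => g u = w).card ^ 2 := by
    rw [Finset.card_eq_sum_card_fiberwise (f := fun x => g x.1) (t := Finset.range B)
      fun u _ => Finset.mem_coe.2 (Finset.mem_range.2 (hg _))]
    refine Finset.sum_congr rfl fun w _ => ?_
    rw [sq, ← Finset.card_product]
    congr 1
    ext x
    simp only [Finset.mem_filter, Finset.mem_product]
    constructor
    · rintro ⟨⟨⟨a, b⟩, c⟩, d⟩; exact ⟨⟨a, d⟩, b, by rw [← c, d]⟩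
    · rintro ⟨⟨a, d⟩, b, c⟩; exact ⟨⟨⟨a, b⟩, by rw [c, d]⟩, d⟩
  rw [h1, h2]
  simpa using sq_sum_le_card_mul_sum_sq (s := Finset.range B)
    (f := fun w => (Q.filter fun u => g u = w).card)

/-- Cut the values into windows of length L: two values in one window differ by less than L. The
summand `Q.card` accounts for the diagonal. -/
theorem sq_card_le_card_close_pairs {n L : ℕ} (hL : 0 < L) (π : Equiv.Perm (Fin n))
    (Q : Finset (Fin n)) :
    Q.card ^ 2 ≤ (n / L + 1) *
      ((Q.offDiag.filter fun x => Nat.dist (π x.1) (π x.2) < L).card + Q.card) := by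
  refine (sq_card_le_card_same_window Q (fun u => (π u : ℕ) / L) (n / L + 1) fun u =>
    Nat.lt_succ_of_le (Nat.div_le_div_right (π u).2.le)).trans (Nat.mul_le_mul_left _ ?_)
  rw [← Finset.diag_card Q]
  refine (Finset.card_le_card fun x hx => ?_).trans (Finset.card_union_le _ _)
  simp only [Finset.mem_filter, Finset.mem_product, Finset.mem_union, Finset.mem_offDiag,
    Finset.mem_diag] at hx ⊢
  obtain ⟨⟨h1, h2⟩, h3⟩ := hx
  by_cases h : x.1 = x.2
  · exact Or.inr ⟨h1, h⟩
  · refine Or.inl ⟨⟨h1, h2, h⟩, ?_⟩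
    have a1 := Nat.div_add_mod (π x.1 : ℕ) L
    have a2 := Nat.div_add_mod (π x.2 : ℕ) L
    have b1 := Nat.mod_lt (π x.1 : ℕ) hL
    have b2 := Nat.mod_lt (π x.2 : ℕ) hL
    rw [h3] at a1
    simp only [Nat.dist]
    omega

/-- Averages the window bound over `spreadPerms`; by symmetry every pair of unused places is close
at most as often as `p`, `q`. -/
theorem card_spreadPerms_mul_le {n L k : ℕ} (hL : 0 < L) {p q : Fin n} (hp : (p : ℕ) = 2 * k)
    (hq : (q : ℕ) = 2 * k + 1) :
    (spreadPerms n L k).card * (n - 2 * k) ^ 2 ≤ (n / L + 1) * ((n - 2 * k) ^ 2 *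
      ((spreadPerms n L k).filter fun π => Nat.dist (π p) (π q) < L).card +
        (spreadPerms n L k).card * (n - 2 * k)) := by
  set A := spreadPerms n L k with hA
  set Q : Finset (Fin n) := Finset.univ.filter fun i => 2 * k ≤ (i : ℕ) ∧ (i : ℕ) < n with hQ
  have hQc : Q.card = n - 2 * k := card_filter_Ico_fin n (2 * k) n le_rfl
  have hmem : ∀ i, i ∈ Q ↔ 2 * k ≤ (i : ℕ) := fun i => by simp [hQ]
  have hswap : ∑ π ∈ A, (Q.offDiag.filter fun x => Nat.dist (π x.1) (π x.2) < L).card =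
      ∑ x ∈ Q.offDiag, (A.filter fun π => Nat.dist (π x.1) (π x.2) < L).card := by
    simp_rw [Finset.card_filter]
    exact Finset.sum_comm
  have hle : ∑ x ∈ Q.offDiag, (A.filter fun π => Nat.dist (π x.1) (π x.2) < L).card ≤
      Q.card ^ 2 * (A.filter fun π => Nat.dist (π p) (π q) < L).card := by
    refine (Finset.sum_le_card_nsmul _ _ _ fun x hx => ?_).trans
      (Nat.mul_le_mul_right _ (?_ : Q.offDiag.card ≤ _))
    · obtain ⟨h1, h2, h3⟩ := Finset.mem_offDiag.1 hx
      exact card_spreadPerms_close_le hp hq ((hmem _).1 h1) ((hmem _).1 h2) h3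
    · rw [Finset.offDiag_card, sq]; exact Nat.sub_le _ _
  calc A.card * (n - 2 * k) ^ 2 = ∑ π ∈ A, Q.card ^ 2 := by
        rw [Finset.sum_const, smul_eq_mul, hQc]
    _ ≤ ∑ π ∈ A, (n / L + 1) *
        ((Q.offDiag.filter fun x => Nat.dist (π x.1) (π x.2) < L).card + Q.card) :=
        Finset.sum_le_sum fun π _ => sq_card_le_card_close_pairs hL π Q
    _ = (n / L + 1) * (∑ π ∈ A, (Q.offDiag.filter fun x => Nat.dist (π x.1) (π x.2) < L).card +
        A.card * Q.card) := by
        rw [← Finset.mul_sum, Finset.sum_add_distrib, Finset.sum_const, smul_eq_mul]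
    _ ≤ _ := by
        rw [hswap, ← hQc]
        exact Nat.mul_le_mul_left _ (Nat.add_le_add_right hle _)

/-- With m = n - 2k ≥ n/2 places left and at most 2n/L windows, the next pair is close with
conditional probability at least L/(2n) - 1/m ≥ (L - 4)/(2n); then 1 - x ≤ e^{-x}. -/
theorem card_spreadPerms_succ_le {n L k : ℕ} (hL : 0 < L) (hLn : L ≤ n) (hk : 4 * (k + 1) ≤ n) :
    ((spreadPerms n L (k + 1)).card : ℝ) ≤
      (spreadPerms n L k).card * Real.exp (-(((L : ℝ) - 4) / (2 * n))) := by
  obtain ⟨p, hp⟩ : ∃ p : Fin n, (p : ℕ) = 2 * k := ⟨⟨2 * k, by omega⟩, rfl⟩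
  obtain ⟨q, hq⟩ : ∃ q : Fin n, (q : ℕ) = 2 * k + 1 := ⟨⟨2 * k + 1, by omega⟩, rfl⟩
  have h := card_spreadPerms_mul_le hL hp hq
  have hsub : spreadPerms n L (k + 1) ⊆
      (spreadPerms n L k).filter fun π => ¬ Nat.dist (π p) (π q) < L := fun π hπ => by
    simp only [spreadPerms, Finset.mem_filter, Finset.mem_univ, true_and, not_lt] at hπ ⊢
    exact ⟨fun i j t ht => hπ i j t (by omega), hπ p q k (by omega) hp hq⟩
  have hcard := Finset.card_le_card hsub
  have hsplit := Finset.card_filter_add_card_filter_not (s := spreadPerms n L k)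
    (fun π => Nat.dist (π p) (π q) < L)
  set a := (spreadPerms n L k).card
  set c := ((spreadPerms n L k).filter fun π => Nat.dist (π p) (π q) < L).card
  set b := (spreadPerms n L (k + 1)).card
  have hbc : (b : ℝ) ≤ a - c := by
    have : b + c ≤ a := by omega
    have : (b : ℝ) + c ≤ a := by exact_mod_cast this
    linarith
  have hn : (0 : ℝ) < n := by exact_mod_cast (by omega : 0 < n)
  have hL' : (0 : ℝ) < L := by exact_mod_cast hL
  have hLn' : (L : ℝ) ≤ n := by exact_mod_cast hLn
  set m : ℝ := (n : ℝ) - 2 * k with hm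
  have hmn : (n : ℝ) / 2 ≤ m := by
    have : (4 : ℝ) * (k + 1) ≤ n := by exact_mod_cast hk
    rw [hm]; linarith
  have hm0 : 0 < m := by linarith
  have hB : (((n / L + 1 : ℕ)) : ℝ) ≤ 2 * n / L := by
    have h1 : ((n / L : ℕ) : ℝ) ≤ n / L := Nat.cast_div_le
    have h2 : (1 : ℝ) ≤ n / L := (one_le_div hL').2 hLn'
    push_cast
    rw [mul_div_assoc]
    linarith
  have h' : (a : ℝ) * m ^ 2 ≤ 2 * n / L * (m ^ 2 * c + a * m) := by
    have e : ((n - 2 * k : ℕ) : ℝ) = m := by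
      rw [Nat.cast_sub (by omega), hm]; push_cast; ring
    have h1 : (a : ℝ) * m ^ 2 ≤ ((n / L + 1 : ℕ) : ℝ) * (m ^ 2 * c + a * m) := by
      rw [← e]; exact_mod_cast h
    exact h1.trans (mul_le_mul_of_nonneg_right hB (by positivity))
  have hc : (a : ℝ) * (((L : ℝ) - 4) / (2 * n)) ≤ c := by
    have h1 : (a : ℝ) * m ≤ 2 * n / L * (m * c + a) := by
      refine le_of_mul_le_mul_right ?_ hm0
      linarith
    have h2 : (a : ℝ) * (L / (2 * n)) ≤ c + a / m := by
      have : 2 * n / L * (m * c + a) = (c + a / m) * (m * (2 * n / L)) := by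
        field_simp
      rw [this] at h1
      have h3 : (a : ℝ) * (L / (2 * n)) * (m * (2 * n / L)) = a * m := by field_simp
      rw [← h3] at h1
      exact le_of_mul_le_mul_right h1 (by positivity)
    have h4 : (a : ℝ) / m ≤ a * (2 / n) := by
      rw [div_eq_mul_inv]
      refine mul_le_mul_of_nonneg_left ?_ (Nat.cast_nonneg _)
      rw [show (2 : ℝ) / n = (n / 2 : ℝ)⁻¹ by rw [inv_div]]
      exact inv_anti₀ (by positivity) hmn
    have h5 : (a : ℝ) * (((L : ℝ) - 4) / (2 * n)) = a * (L / (2 * n)) - a * (2 / n) := by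
      field_simp; ring
    linarith
  calc (b : ℝ) ≤ a * (-(((L : ℝ) - 4) / (2 * n)) + 1) := by linarith
    _ ≤ _ := mul_le_mul_of_nonneg_left (Real.add_one_le_exp _) (Nat.cast_nonneg _)

theorem card_spreadPerms_le {n L : ℕ} (hL : 0 < L) (hLn : L ≤ n) (k : ℕ) (hk : 4 * k ≤ n) :
    ((spreadPerms n L k).card : ℝ) ≤
      n.factorial * Real.exp (-(((L : ℝ) - 4) / (2 * n))) ^ k := by
  induction k with
  | zero =>
    rw [pow_zero, mul_one]
    have := Finset.card_le_univ (spreadPerms n L 0)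
    rw [Fintype.card_perm, Fintype.card_fin] at this
    exact_mod_cast this
  | succ k ih =>
    rw [pow_succ, ← mul_assoc]
    exact (card_spreadPerms_succ_le hL hLn hk).trans
      (mul_le_mul_of_nonneg_right (ih (by omega)) (Real.exp_pos _).le)

/-- The minimum Manhattan distance has exponential tails, uniformly in `n`. -/
theorem card_lt_minManhattanDist_le {n : ℕ} (hn : 4 ≤ n) (L : ℕ) :
    ((Finset.univ.filter fun π : Equiv.Perm (Fin n) => L < minManhattanDist π).card : ℝ) /
      n.factorial ≤ Real.exp (-(((L : ℝ) - 4) / 16)) := by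
  have hf : (0 : ℝ) < n.factorial := by positivity
  rcases lt_or_ge L 4 with h4 | h4
  · have hle : ((Finset.univ.filter fun π : Equiv.Perm (Fin n) =>
        L < minManhattanDist π).card : ℝ) ≤ n.factorial := by
      have := Finset.card_le_univ (Finset.univ.filter fun π : Equiv.Perm (Fin n) =>
        L < minManhattanDist π)
      rw [Fintype.card_perm, Fintype.card_fin] at this
      exact_mod_cast this
    refine ((div_le_one hf).2 hle).trans (Real.one_le_exp ?_)
    have : (L : ℝ) < 4 := by exact_mod_cast h4
    linarith
  have h4' : (4 : ℝ) ≤ L := by exact_mod_cast h4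
  rcases lt_or_ge n L with hLn | hLn
  -- The dots at places 0 and 1 are at distance at most 1 + (n - 1) = n < L.
  · rw [Finset.filter_eq_empty_iff.2 fun π _ hπ => ?_]
    · simpa using (Real.exp_pos _).le
    · have h := (le_minManhattanDist_iff (by omega) π (L + 1)).1 hπ ⟨0, by omega⟩ ⟨1, by omega⟩
        (by simp)
      have h0 := (π ⟨0, by omega⟩).2
      have h1 := (π ⟨1, by omega⟩).2
      simp only [manhattanDist, Nat.dist] at h
      omega
  rw [div_le_iff₀ hf, mul_comm]
  -- Neighbouring places contribute only 1 to the distance, so distance at least L + 1 leaves at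
  -- least L for the values.
  have hsub : (Finset.univ.filter fun π : Equiv.Perm (Fin n) => L < minManhattanDist π) ⊆
      spreadPerms n L (n / 4) := fun π hπ => by
    simp only [spreadPerms, Finset.mem_filter, Finset.mem_univ, true_and] at hπ ⊢
    intro i j t _ hi hj
    have h := (le_minManhattanDist_iff (by omega) π (L + 1)).1 hπ i j (by
      rw [Fin.lt_def]; omega)
    rw [manhattanDist, show Nat.dist i j = 1 by rw [Nat.dist]; omega] at h
    omega
  calc _ ≤ ((spreadPerms n L (n / 4)).card : ℝ) := by exact_mod_cast Finset.card_le_card hsub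
    _ ≤ n.factorial * Real.exp (-(((L : ℝ) - 4) / (2 * n))) ^ (n / 4) :=
        card_spreadPerms_le (by omega) hLn _ (Nat.mul_div_le n 4)
    _ ≤ _ := by
        refine mul_le_mul_of_nonneg_left ?_ hf.le
        rw [← Real.exp_nat_mul]
        refine Real.exp_le_exp.2 ?_
        have hn' : (0 : ℝ) < n := by exact_mod_cast (by omega : 0 < n)
        -- Rounding down n/4 costs at most a factor 2 once n ≥ 4, whence 16 = 2 · 8 in the exponent.
        have hq : (n : ℝ) ≤ 8 * ((n / 4 : ℕ) : ℝ) := by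
          exact_mod_cast (by omega : n ≤ 8 * (n / 4))
        rw [mul_neg, neg_le_neg_iff, mul_div_assoc', div_le_div_iff₀ (by norm_num) (by positivity)]
        nlinarith [mul_le_mul_of_nonneg_left hq (sub_nonneg.2 h4')]

/-! ### Numerical value of the limiting mean -/

theorem summable_limitTail : Summable limitTail := by
  refine Summable.of_nonneg_of_le (fun d => (Real.exp_pos _).le) (fun d => ?_)
    Real.summable_exp_neg_nat
  exact Real.exp_le_exp.2 (by nlinarith [sq_nonneg (d : ℝ)])

theorem exp_neg_one_bounds :
    (0.3678794411714423215955237 : ℝ) ≤ Real.exp (-1) ∧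
      Real.exp (-1) ≤ 0.3678794411714423215955238 := by
  -- The remainder after 28 terms is below 10⁻²⁹, against a bracket of width 10⁻²⁵.
  have h := Real.exp_bound (x := -1) (by norm_num) (n := 28) (by norm_num)
  rw [abs_le] at h
  norm_num [Finset.sum_range_succ, Nat.factorial] at h
  constructor <;> linarith [h.1, h.2]

theorem tsum_limitTail_bounds :
    |(1 + ∑' d : ℕ, limitTail d) - 2.1378201816868795778| < 5 / 10 ^ 20 := by
  have hpow : ∀ d : ℕ, limitTail d = Real.exp (-1) ^ (d ^ 2 + d) := fun d => by
    rw [limitTail, ← Real.exp_nat_mul]; push_cast; ring_nf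
  obtain ⟨hl, hu⟩ := exp_neg_one_bounds
  set x := Real.exp (-1) with hx
  have hx0 : 0 < x := Real.exp_pos _
  have htail0 : 0 ≤ ∑' d : ℕ, limitTail (d + 7) := tsum_nonneg fun d => (Real.exp_pos _).le
  -- The omitted terms start at exponent 7² + 7 = 56 and are dominated by a geometric series of
  -- ratio 1/2.
  have htail : ∑' d : ℕ, limitTail (d + 7) ≤ 1 / 10 ^ 23 := by
    have hg : HasSum (fun d : ℕ => x ^ 56 * (1 / 2) ^ d) (x ^ 56 * 2) :=
      (hasSum_geometric_two).mul_left _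
    have hle : ∑' d : ℕ, limitTail (d + 7) ≤ x ^ 56 * 2 := by
      rw [← hg.tsum_eq]
      refine ((summable_nat_add_iff 7).2 summable_limitTail).tsum_le_tsum (fun d => ?_) hg.summable
      rw [hpow, show (d + 7) ^ 2 + (d + 7) = 56 + d + (d ^ 2 + 14 * d) by ring, pow_add, pow_add,
        mul_assoc]
      refine mul_le_mul_of_nonneg_left ?_ (by positivity)
      calc x ^ d * x ^ (d ^ 2 + 14 * d) ≤ x ^ d * 1 := by
            refine mul_le_mul_of_nonneg_left (pow_le_one₀ hx0.le ?_) (by positivity)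
            linarith
        _ ≤ (1 / 2) ^ d := by
            rw [mul_one]; exact pow_le_pow_left₀ hx0.le (by linarith) d
    have : x ^ 56 ≤ 0.3678794411714423215955238 ^ 56 := pow_le_pow_left₀ hx0.le hu _
    norm_num at this ⊢
    linarith
  have hsplit := summable_limitTail.sum_add_tsum_nat_add 7
  rw [← hsplit]
  simp only [Finset.sum_range_succ, Finset.sum_range_zero, hpow] at htail htail0 ⊢
  have l2 := pow_le_pow_left₀ (by norm_num) hl 2
  have l6 := pow_le_pow_left₀ (by norm_num) hl 6
  have l12 := pow_le_pow_left₀ (by norm_num) hl 12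
  have l20 := pow_le_pow_left₀ (by norm_num) hl 20
  have l30 := pow_le_pow_left₀ (by norm_num) hl 30
  have l42 := pow_le_pow_left₀ (by norm_num) hl 42
  have u2 := pow_le_pow_left₀ hx0.le hu 2
  have u6 := pow_le_pow_left₀ hx0.le hu 6
  have u12 := pow_le_pow_left₀ hx0.le hu 12
  have u20 := pow_le_pow_left₀ hx0.le hu 20
  have u30 := pow_le_pow_left₀ hx0.le hu 30
  have u42 := pow_le_pow_left₀ hx0.le hu 42
  norm_num at l2 l6 l12 l20 l30 l42 u2 u6 u12 u20 u30 u42 htail ⊢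
  rw [abs_lt]
  constructor <;> linarith

/-! ### From tails to moments -/

/-- The tail `Pr[Y ≥ m]` of the limit variable. -/
noncomputable def limitTailFrom (m : ℕ) : ℝ := if m < 2 then 1 else limitTail (m - 2)

/-- The tail `Pr[Y_n ≥ m]`. -/
noncomputable def minDistTail (n m : ℕ) : ℝ :=
  ((Finset.univ.filter fun π : Equiv.Perm (Fin n) => m ≤ minManhattanDist π).card : ℝ) /
    (n.factorial : ℝ)

theorem minDistTail_nonneg (n m : ℕ) : 0 ≤ minDistTail n m := by
  unfold minDistTail; positivity

theorem minDistTail_le_one (n m : ℕ) : minDistTail n m ≤ 1 := by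
  have hf : (0 : ℝ) < n.factorial := by positivity
  rw [minDistTail, div_le_one hf]
  have := Finset.card_le_univ (Finset.univ.filter fun π : Equiv.Perm (Fin n) =>
    m ≤ minManhattanDist π)
  rw [Fintype.card_perm, Fintype.card_fin] at this
  exact_mod_cast this

theorem two_le_minManhattanDist {n : ℕ} (hn : 2 ≤ n) (π : Equiv.Perm (Fin n)) :
    2 ≤ minManhattanDist π := by
  rw [le_minManhattanDist_iff hn]
  intro i j hij
  have h : (π i : ℕ) ≠ π j := fun h => hij.ne (π.injective (Fin.ext h))
  rw [Fin.lt_def] at hij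
  simp only [manhattanDist, Nat.dist]
  omega

theorem tendsto_minDistTail (m : ℕ) :
    Tendsto (fun n => minDistTail n m) atTop (𝓝 (limitTailFrom m)) := by
  rw [limitTailFrom]
  split_ifs with h
  · refine tendsto_const_nhds.congr' ?_
    filter_upwards [eventually_ge_atTop 2] with n hn
    have hf : (n.factorial : ℝ) ≠ 0 := by positivity
    rw [minDistTail, Finset.filter_true_of_mem fun π _ => by
      have := two_le_minManhattanDist hn π; omega, Finset.card_univ, Fintype.card_perm,
      Fintype.card_fin, div_self hf]
  · obtain ⟨d, rfl⟩ := Nat.exists_eq_add_of_le' (not_lt.1 h)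
    exact tendsto_card_le_minManhattanDist d

theorem minDistTail_le {n : ℕ} (hn : 4 ≤ n) (m : ℕ) :
    minDistTail n m ≤ Real.exp (5 / 16) * Real.exp (-(1 / 16)) ^ m := by
  rw [← Real.exp_nat_mul, ← Real.exp_add]
  rcases m with _ | m
  · exact (minDistTail_le_one n 0).trans (Real.one_le_exp (by norm_num))
  -- At least m + 1 means more than m, and -(m - 4)/16 = 5/16 - (m + 1)/16.
  · refine (card_lt_minManhattanDist_le hn m).trans_eq ?_
    push_cast
    ring_nf

theorem minDistLaw_apply_toReal (n m : ℕ) :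
    (minDistLaw n m).toReal = minDistTail n m - minDistTail n (m + 1) := by
  classical
  have h1 : minDistLaw n m = ((Finset.univ.filter fun π : Equiv.Perm (Fin n) =>
      m = minManhattanDist π).card : ENNReal) * (n.factorial : ENNReal)⁻¹ := by
    rw [minDistLaw, PMF.map_apply, tsum_fintype, Finset.card_filter, Nat.cast_sum, Finset.sum_mul]
    refine Finset.sum_congr rfl fun π _ => ?_
    rw [PMF.uniformOfFintype_apply, Fintype.card_perm, Fintype.card_fin]
    split_ifs <;> simp
  have h2 : (Finset.univ.filter fun π : Equiv.Perm (Fin n) => m = minManhattanDist π).card +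
      (Finset.univ.filter fun π : Equiv.Perm (Fin n) => m + 1 ≤ minManhattanDist π).card =
      (Finset.univ.filter fun π : Equiv.Perm (Fin n) => m ≤ minManhattanDist π).card := by
    rw [← Finset.card_union_of_disjoint]
    · congr 1
      ext π
      simp only [Finset.mem_filter, Finset.mem_univ, true_and, Finset.mem_union]
      omega
    · exact Finset.disjoint_filter.2 fun π _ h => by omega
  rw [h1, ENNReal.toReal_mul, ENNReal.toReal_inv, ENNReal.toReal_natCast, ENNReal.toReal_natCast,
    minDistTail, minDistTail, ← h2]
  push_cast
  ring

theorem limitLaw_apply_toReal (m : ℕ) :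
    (limitLaw m).toReal = limitTailFrom m - limitTailFrom (m + 1) := by
  rw [limitLaw, PMF.map_apply]
  rcases lt_or_ge m 2 with h | h
  · have h0 : ∀ a : ℕ, m ≠ a + 2 := fun a => by omega
    simp only [h0, if_false, tsum_zero, ENNReal.toReal_zero]
    interval_cases m
    · simp [limitTailFrom]
    · simp [limitTailFrom, limitTail_zero]
  · obtain ⟨d, rfl⟩ := Nat.exists_eq_add_of_le' h
    trans (limitShiftedLaw d).toReal
    · congr 1
      exact (tsum_eq_single d fun a ha => if_neg fun h => ha (by omega)).trans (if_pos rfl)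
    change (ENNReal.ofReal (limitTail d - limitTail (d + 1))).toReal = _
    rw [ENNReal.toReal_ofReal (sub_nonneg.2 (limitTail_succ_le d))]
    simp [limitTailFrom]

theorem PMF.integrable_of_summable (p : PMF ℕ) {f : ℕ → ℝ}
    (hf : Summable fun m => (p m).toReal * ‖f m‖) : Integrable f p.toMeasure := by
  refine ⟨(measurable_of_countable f).aestronglyMeasurable, ?_⟩
  rw [HasFiniteIntegral, lintegral_countable']
  have h : ∀ m, ‖f m‖ₑ * p.toMeasure {m} = ENNReal.ofReal ((p m).toReal * ‖f m‖) := fun m => by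
    rw [PMF.toMeasure_apply_singleton p m (measurableSet_singleton m),
      ENNReal.ofReal_mul ENNReal.toReal_nonneg, ENNReal.ofReal_toReal (p.apply_ne_top m),
      ofReal_norm, mul_comm]
  simp_rw [h]
  rw [← ENNReal.ofReal_tsum_of_nonneg (fun m => by positivity) hf]
  exact ENNReal.ofReal_lt_top

/-- The geometric bound passes to the limit, so one summable sequence dominates the moment series of
Y and of all Y_n with n ≥ 4. -/
theorem limitTailFrom_le (m : ℕ) :
    limitTailFrom m ≤ Real.exp (5 / 16) * Real.exp (-(1 / 16)) ^ m :=
  le_of_tendsto (tendsto_minDistTail m) (by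
    filter_upwards [eventually_ge_atTop 4] with n hn using minDistTail_le hn m)

theorem limitTailFrom_nonneg (m : ℕ) : 0 ≤ limitTailFrom m :=
  ge_of_tendsto' (tendsto_minDistTail m) fun n => minDistTail_nonneg n m

theorem summable_moment_bound (a : ℕ) :
    Summable fun m : ℕ => Real.exp (5 / 16) * Real.exp (-(1 / 16)) ^ m * (m : ℝ) ^ a := by
  have h : Summable fun m : ℕ => (m : ℝ) ^ a * Real.exp (-(1 / 16)) ^ m :=
    summable_pow_mul_geometric_of_norm_lt_one a (by
      rw [Real.norm_eq_abs, Real.abs_exp, Real.exp_lt_one_iff]; norm_num)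
  refine (h.mul_left (Real.exp (5 / 16))).congr fun m => ?_
  ring

theorem limitLaw_moment_term_le (a m : ℕ) : (limitLaw m).toReal * ‖(m : ℝ) ^ a‖ ≤
    Real.exp (5 / 16) * Real.exp (-(1 / 16)) ^ m * (m : ℝ) ^ a := by
  rw [Real.norm_of_nonneg (by positivity)]
  refine mul_le_mul_of_nonneg_right ?_ (by positivity)
  rw [limitLaw_apply_toReal]
  linarith [limitTailFrom_le m, limitTailFrom_nonneg (m + 1)]

theorem minDistLaw_moment_term_le {n : ℕ} (hn : 4 ≤ n) (a m : ℕ) :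
    (minDistLaw n m).toReal * ‖(m : ℝ) ^ a‖ ≤
      Real.exp (5 / 16) * Real.exp (-(1 / 16)) ^ m * (m : ℝ) ^ a := by
  rw [Real.norm_of_nonneg (by positivity)]
  refine mul_le_mul_of_nonneg_right ?_ (by positivity)
  rw [minDistLaw_apply_toReal]
  linarith [minDistTail_le hn m, minDistTail_nonneg n (m + 1)]

theorem integrable_pow_limitLaw (a : ℕ) :
    Integrable (fun y : ℕ => (y : ℝ) ^ a) limitLaw.toMeasure :=
  PMF.integrable_of_summable _ (Summable.of_nonneg_of_le (fun m => by positivity)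
    (limitLaw_moment_term_le a) (summable_moment_bound a))

theorem integrable_pow_minDistLaw {n : ℕ} (hn : 4 ≤ n) (a : ℕ) :
    Integrable (fun y : ℕ => (y : ℝ) ^ a) (minDistLaw n).toMeasure :=
  PMF.integrable_of_summable _ (Summable.of_nonneg_of_le (fun m => by positivity)
    (minDistLaw_moment_term_le hn a) (summable_moment_bound a))

theorem tendsto_moment_minDistLaw (a : ℕ) :
    Tendsto (fun n : ℕ => moment (fun y : ℕ => (y : ℝ)) a (minDistLaw n).toMeasure) atTop
      (𝓝 (moment (fun y : ℕ => (y : ℝ)) a limitLaw.toMeasure)) := by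
  have hlim : moment (fun y : ℕ => (y : ℝ)) a limitLaw.toMeasure =
      ∑' m : ℕ, (limitLaw m).toReal * (m : ℝ) ^ a :=
    PMF.integral_eq_tsum limitLaw (fun y : ℕ => (y : ℝ) ^ a) (integrable_pow_limitLaw a)
  rw [hlim]
  have h : Tendsto (fun n : ℕ => ∑' m : ℕ, (minDistLaw n m).toReal * (m : ℝ) ^ a) atTop
      (𝓝 (∑' m : ℕ, (limitLaw m).toReal * (m : ℝ) ^ a)) := by
    refine tendsto_tsum_of_dominated_convergence (summable_moment_bound a) (fun m => ?_) ?_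
    · simp_rw [minDistLaw_apply_toReal, limitLaw_apply_toReal]
      exact ((tendsto_minDistTail m).sub (tendsto_minDistTail (m + 1))).mul_const _
    · filter_upwards [eventually_ge_atTop 4] with n hn m
      rw [norm_mul, Real.norm_of_nonneg ENNReal.toReal_nonneg]
      exact minDistLaw_moment_term_le hn a m
  refine h.congr' ?_
  filter_upwards [eventually_ge_atTop 4] with n hn
  exact (PMF.integral_eq_tsum (minDistLaw n) (fun y : ℕ => (y : ℝ) ^ a)
    (integrable_pow_minDistLaw hn a)).symm

/-- The mean of a natural-valued variable is the sum of its tails. -/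
theorem hasSum_minDistTail_succ (n : ℕ) : HasSum (fun m => minDistTail n (m + 1))
    ((∑ π : Equiv.Perm (Fin n), (minManhattanDist π : ℝ)) / (n.factorial : ℝ)) := by
  have h : ∀ π : Equiv.Perm (Fin n), HasSum
      (fun m : ℕ => if m + 1 ≤ minManhattanDist π then (1 : ℝ) else 0) (minManhattanDist π) := by
    intro π
    have h1 := hasSum_sum_of_ne_finset_zero (L := .unconditional ℕ)
      (f := fun m : ℕ => if m + 1 ≤ minManhattanDist π then (1 : ℝ) else 0)
      (s := Finset.range (minManhattanDist π)) fun m hm => if_neg fun h => hm (Finset.mem_range.2 h)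
    rwa [Finset.sum_congr rfl fun m hm => if_pos (Nat.succ_le_of_lt (Finset.mem_range.1 hm)),
      Finset.sum_const, Finset.card_range, nsmul_eq_mul, mul_one] at h1
  have h2 := (hasSum_sum (L := .unconditional ℕ) (s := Finset.univ) fun π _ => h π).div_const (n.factorial : ℝ)
  have h3 : (fun m => minDistTail n (m + 1)) = fun m : ℕ => (∑ π : Equiv.Perm (Fin n),
      if m + 1 ≤ minManhattanDist π then (1 : ℝ) else 0) / (n.factorial : ℝ) := by
    funext m
    rw [minDistTail, Finset.card_filter]
    push_cast
    rfl
  rw [h3]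
  exact h2

theorem tendsto_mean_minManhattanDist :
    Tendsto (fun n : ℕ => (∑ π : Equiv.Perm (Fin n), (minManhattanDist π : ℝ)) /
      (n.factorial : ℝ)) atTop (𝓝 (1 + ∑' d : ℕ, limitTail d)) := by
  have hsum : Summable fun m => limitTailFrom (m + 1) :=
    (summable_nat_add_iff (f := fun m => limitTailFrom (m + 1)) 1).1
      (summable_limitTail.congr fun d => by simp [limitTailFrom])
  -- The extra 1 is Pr[Y ≥ 1]; the later terms are Pr[Y ≥ d + 2].
  have hval : ∑' m, limitTailFrom (m + 1) = 1 + ∑' d, limitTail d := by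
    rw [hsum.tsum_eq_zero_add]
    simp [limitTailFrom]
  rw [← hval]
  have hb : Summable fun m : ℕ => Real.exp (5 / 16) * Real.exp (-(1 / 16)) ^ (m + 1) :=
    (summable_nat_add_iff
      (f := fun m : ℕ => Real.exp (5 / 16) * Real.exp (-(1 / 16)) ^ m) 1).2
      ((summable_moment_bound 0).congr fun m => by rw [pow_zero, mul_one])
  refine (tendsto_tsum_of_dominated_convergence hb (fun m => tendsto_minDistTail (m + 1)) ?_).congr
    fun n => (hasSum_minDistTail_succ n).tsum_eq
  filter_upwards [eventually_ge_atTop 4] with n hn m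
  rw [Real.norm_of_nonneg (minDistTail_nonneg _ _)]
  exact minDistTail_le hn (m + 1)

theorem limitTail_le_one (d : ℕ) : limitTail d ≤ 1 := by
  rw [← limitTail_zero]
  exact antitone_nat_of_succ_le limitTail_succ_le (Nat.zero_le d)

theorem limitLaw_toMeasure_tail (d : ℕ) :
    limitLaw.toMeasure {y : ℕ | d + 2 ≤ y} = ENNReal.ofReal (limitTail d) := by
  rw [limitLaw, PMF.toMeasure_map_apply _ _ _ (measurable_of_countable _)
    (Set.to_countable _).measurableSet]
  have hset : (fun d : ℕ => d + 2) ⁻¹' {y : ℕ | d + 2 ≤ y} = (↑(Finset.range d) : Set ℕ)ᶜ := by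
    ext y; simp
  rw [hset, prob_compl_eq_one_sub (Finset.measurableSet _), PMF.toMeasure_apply_finset]
  change 1 - ∑ x ∈ Finset.range d, ENNReal.ofReal (limitTail x - limitTail (x + 1)) = _
  rw [← ENNReal.ofReal_sum_of_nonneg fun x _ => sub_nonneg.2 (limitTail_succ_le x),
    Finset.sum_range_sub', limitTail_zero, ← ENNReal.ofReal_one,
    ← ENNReal.ofReal_sub _ (sub_nonneg.2 (limitTail_le_one d)), sub_sub_cancel]

theorem theorem3 :
    -- the limit variable has the tails `Pr[Y ≥ d + 2] = e^{-d² - d}`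
    (∀ d : ℕ, limitLaw.toMeasure {y : ℕ | d + 2 ≤ y} =
      ENNReal.ofReal (Real.exp (-(d : ℝ) ^ 2 - (d : ℝ)))) ∧
    -- for every `a`, the `a`-th moment of `Y` is finite and is the limit of those of `Y_n`
    (∀ a : ℕ,
      Integrable (fun y : ℕ => (y : ℝ) ^ a) limitLaw.toMeasure ∧
      Tendsto (fun n : ℕ => moment (fun y : ℕ => (y : ℝ)) a (minDistLaw n).toMeasure) atTop
        (𝓝 (moment (fun y : ℕ => (y : ℝ)) a limitLaw.toMeasure))) ∧
    -- the expected minimum Manhattan distance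
    Summable (fun d : ℕ => Real.exp (-(d : ℝ) ^ 2 - (d : ℝ))) ∧
    Tendsto (fun n : ℕ => (∑ π : Equiv.Perm (Fin n), (minManhattanDist π : ℝ)) /
        (Nat.factorial n : ℝ)) atTop
      (𝓝 (1 + ∑' d : ℕ, Real.exp (-(d : ℝ) ^ 2 - (d : ℝ)))) ∧
    -- its numerical value, correctly rounded to 19 decimal places
    |(1 + ∑' d : ℕ, Real.exp (-(d : ℝ) ^ 2 - (d : ℝ))) - 2.1378201816868795778| < 5 / 10 ^ 20 :=
  ⟨limitLaw_toMeasure_tail, fun a => ⟨integrable_pow_limitLaw a, tendsto_moment_minDistLaw a⟩,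
    summable_limitTail, tendsto_mean_minManhattanDist, tsum_limitTail_bounds⟩
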